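/- Let $m=m(n)$ with $m/n\to\alpha\in(0,\infty)$ as $n\to\infty$, and let $c>0$, $x\ge 0$ with $x^2\le c$; put $r=\sqrt{c-x^2}$. Let $A\in\mathbb R^{m\times n}$, $\mathbf g^{(1)}\in\mathbb R^{m}$, $\mathbf h^{(1)}\in\mathbb R^{n-1}$ have independent standard normal entries, let $\mathbf g^{(0)}=A_{:,1}$ be the first column of $A$, $A_{:,2:n}$ the remaining columns, and $\mathcal G=(A,\mathbf g^{(1)},\mathbf h^{(1)})$. Absolute values of vectors are taken entrywise. For a unit vector $\bar{\mathbf x}\in\mathbb R^n$ let $$\xi(c,x;A,\bar{\mathbf x})=\min\bigl\{\||A\bar{\mathbf x}|-|\mathbf z|\|_2^2 : A\mathbf x=\mathbf z,\ \mathbf x^T\bar{\mathbf x}=x,\ \|\mathbf x\|_2^2=c\bigr\},$$ $$f_{rp}(c,x;A)=\frac1n\min_{\|\mathbf w\|_2=r,\ \mathbf z}\ \max_{\mathbf y\in\mathbb R^m}\Bigl(\||\mathbf g^{(0)}|-|\mathbf z|\|_2^2+\mathbf y^T\mathbf g^{(0)}x+\mathbf y^TA_{:,2:n}\mathbf w-\mathbf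 y^T\mathbf z\Bigr),$$ $$f_{rd}(c,x;\mathcal G)=\frac1n\min_{\|\mathbf w\|_2=r,\ \mathbf z}\ \max_{r_y>0,\ \|\mathbf y\|_2=r_y}\Bigl(\||\mathbf g^{(0)}|-|\mathbf z|\|_2^2+\mathbf y^T\mathbf g^{(0)}x+\mathbf y^T\mathbf g^{(1)}\|\mathbf w\|_2+\mathbf w^T\mathbf h^{(1)}\|\mathbf y\|_2-\mathbf y^T\mathbf z\Bigr),$$ where $\mathbf w\in\mathbb R^{n-1}$, $\mathbf z\in\mathbb R^m$, and maxima may be $+\infty$. Phase retrieval of $\bar{\mathbf x}$ is called uniquely solvable if $|A\mathbf x|^2=|A\bar{\mathbf x}|^2$ implies $\mathbf x=\pm\bar{\mathbf x}$ for all $\mathbf x\in\mathbb R^n$. Then $f_{rp}(c,x;A)=\frac1n\xi(c,x;A,\mathbf e_1)$ for every $A$; for all large $n$, $f_{rd}(c,x;\mathcal G)$ is finite and integrable; and the limit $$\phi_0=\lim_{n\to\infty}\mathbb E_{\mathcal G}f_{rd}(c,x;\mathcal G)\in\mathbb R$$ exists. Moreover: 1. For every $\varepsilon>0$, $\mathbb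 P_A\bigl(f_{rp}(c,x;A)>\phi_0-\varepsilon\bigr)\to1$. 2. If $\phi_0>0$, then $\mathbb P_{\mathcal G}\bigl(f_{rd}(c,x;\mathcal G)>0\text{ and }f_{rp}(c,x;A)>0\bigr)\to1$; in particular $\mathbb P_A\bigl(f_{rp}(c,x;A)>0\bigr)\to1$. 3. Let $\bar{\mathbf x}=\bar{\mathbf x}_n\in\mathbb R^n$ be any deterministic unit vectors. Then $\mathbb P_A\bigl(\frac1n\xi(c,x;A,\bar{\mathbf x})>\phi_0-\varepsilon\bigr)\to1$ for every $\varepsilon>0$, and, if $\phi_0>0$, $\mathbb P_A\bigl(\xi(c,x;A,\bar{\mathbf x})>0\bigr)\to1$. For every fixed matrix $A$, if $\xi(c',x';A,\bar{\mathbf x})>0$ for all $(c',x')\ne(1,\pm1)$ (with $\xi=+\infty$ where the constraints are infeasible), then phase retrieval of $\bar{\mathbf x}$ is uniquely solvable. If $c=1$ and $\phi_0>0$, then $\mathbb P_A\bigl(\text{phase retrieval of }\bar{\mathbf x}\text{ is uniquely solvable}\bigr)\to1$. -/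

import Mathlib

open MeasureTheory ProbabilityTheory Filter Topology
open scoped Matrix

noncomputable section

namespace PhaseRetrieval

/-- The law of an `m × n` matrix with iid standard normal entries. -/
def gaussMatrix (m n : ℕ) : Measure (Fin m → Fin n → ℝ) :=
  Measure.pi fun _ => Measure.pi fun _ => gaussianReal 0 1

/-- The law of a vector in `ℝ^d` with iid standard normal entries. -/
def gaussVector (d : ℕ) : Measure (Fin d → ℝ) :=
  Measure.pi fun _ => gaussianReal 0 1

/-- The joint law of `𝒢 = (A, g⁽¹⁾, h⁽¹⁾)`, all entries iid standard normal, for `n = k + 1`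
unknowns: `A` is `m × (k + 1)`, `g⁽¹⁾ ∈ ℝ^m`, `h⁽¹⁾ ∈ ℝ^k`. -/
def gaussTriple (m k : ℕ) :
    Measure ((Fin m → Fin (k + 1) → ℝ) × (Fin m → ℝ) × (Fin k → ℝ)) :=
  (gaussMatrix m (k + 1)).prod ((gaussVector m).prod (gaussVector k))

/-- The matrix-vector product `A x`. -/
def meas {m n : ℕ} (A : Fin m → Fin n → ℝ) (x : EuclideanSpace ℝ (Fin n)) (i : Fin m) : ℝ :=
  ∑ j, A i j * x j

/-- Phase retrieval of `xbar` from `|A xbar|²` is uniquely solvable: `± xbar` are the only `x` with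
`|A x|² = |A xbar|²`, among all `x ∈ ℝ^n`. -/
def UniquelySolvable {m n : ℕ} (A : Fin m → Fin n → ℝ) (xbar : EuclideanSpace ℝ (Fin n)) : Prop :=
  ∀ x : EuclideanSpace ℝ (Fin n),
    (∀ i, |meas A x i| ^ 2 = |meas A xbar i| ^ 2) → x = xbar ∨ x = -xbar

/-- The optimal value `ξ(c, x)` of the fundamental phase-retrieval optimization: the minimum of
`‖|A xbar| - |z|‖²` over the pairs `(u, z)` with `A u = z`, `uᵀ xbar = x`, `‖u‖² = c`.
It is `⊤` when there is no such pair. -/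
def fpro {m n : ℕ} (c x : ℝ) (A : Fin m → Fin n → ℝ) (xbar : EuclideanSpace ℝ (Fin n)) : EReal :=
  ⨅ p ∈ {p : EuclideanSpace ℝ (Fin n) × EuclideanSpace ℝ (Fin m) |
      (∀ i, meas A p.1 i = p.2 i) ∧ inner ℝ p.1 xbar = x ∧ ‖p.1‖ ^ 2 = c},
    ((∑ i, (|meas A xbar i| - |p.2 i|) ^ 2 : ℝ) : EReal)

/-- The function optimized in the random primal, `w` standing for `x_{2:n}`:
`‖|g⁽⁰⁾| - |z|‖² + yᵀ g⁽⁰⁾ x + yᵀ A_{:,2:n} w - yᵀ z`, where `g⁽⁰⁾` is the first column of `A`. -/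
def primalFun {m k : ℕ} (x : ℝ) (A : Fin m → Fin (k + 1) → ℝ)
    (w : EuclideanSpace ℝ (Fin k)) (z y : EuclideanSpace ℝ (Fin m)) : ℝ :=
  ∑ i, (|A i 0| - |z i|) ^ 2 + (∑ i, y i * A i 0) * x
    + ∑ i, y i * ∑ j : Fin k, A i j.succ * w j - ∑ i, y i * z i

/-- The random primal: `f_rp(c, x; A) = (1/n) min_{‖w‖ = r, z} max_y primalFun`, with
`r = √(c - x²)` and `n = k + 1`. The inner maximum can be infinite, hence the values in `EReal`. -/
def frp {m k : ℕ} (c x : ℝ) (A : Fin m → Fin (k + 1) → ℝ) : EReal :=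
  (⨅ w ∈ {w : EuclideanSpace ℝ (Fin k) | ‖w‖ = √(c - x ^ 2)},
    ⨅ z : EuclideanSpace ℝ (Fin m), ⨆ y : EuclideanSpace ℝ (Fin m),
      (primalFun x A w z y : EReal)) / (((k + 1 : ℕ) : ℝ) : EReal)

/-- The decoupled function `φ(w, z, y)`:
`‖|g⁽⁰⁾| - |z|‖² + yᵀ g⁽⁰⁾ x + yᵀ g⁽¹⁾ ‖w‖ + wᵀ h⁽¹⁾ ‖y‖ - yᵀ z`. -/
def dualFun {m k : ℕ} (x : ℝ)
    (G : (Fin m → Fin (k + 1) → ℝ) × (Fin m → ℝ) × (Fin k → ℝ))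
    (w : EuclideanSpace ℝ (Fin k)) (z y : EuclideanSpace ℝ (Fin m)) : ℝ :=
  ∑ i, (|G.1 i 0| - |z i|) ^ 2 + (∑ i, y i * G.1 i 0) * x
    + (∑ i, y i * G.2.1 i) * ‖w‖ + (∑ j, w j * G.2.2 j) * ‖y‖ - ∑ i, y i * z i

/-- The random dual:
`f_rd(c, x; 𝒢) = (1/n) min_{‖w‖ = r, z} max_{‖y‖ = r_y, r_y > 0} φ(w, z, y)`, the maximum being
over both `r_y > 0` and the vectors `y` of norm `r_y`. -/
def frd {m k : ℕ} (c x : ℝ)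
    (G : (Fin m → Fin (k + 1) → ℝ) × (Fin m → ℝ) × (Fin k → ℝ)) : EReal :=
  (⨅ w ∈ {w : EuclideanSpace ℝ (Fin k) | ‖w‖ = √(c - x ^ 2)},
    ⨅ z : EuclideanSpace ℝ (Fin m),
      ⨆ ry ∈ Set.Ioi (0 : ℝ), ⨆ y ∈ {y : EuclideanSpace ℝ (Fin m) | ‖y‖ = ry},
        (dualFun x G w z y : EReal)) / (((k + 1 : ℕ) : ℝ) : EReal)

end PhaseRetrieval

end

/-!
The random dual has a closed form. For fixed `w`, `z` the maximum over `y` is `⊤` unless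
`‖x g⁽⁰⁾ + r g⁽¹⁾ - z‖ ≤ -⟪w, h⁽¹⁾⟫`, and the best `w` opposes `h⁽¹⁾`; so `z` ranges over a ball of
radius `r ‖h⁽¹⁾‖`, and the nearest one to `g⁽⁰⁾` modulo signs is found by moving entrywise absolute
values (`exists_abs_approx`). Hence `frd` is `max 0 gap ^ 2 / n` with
`gap = ‖|g⁽⁰⁾| - |x g⁽⁰⁾ + r g⁽¹⁾|‖ - r ‖h⁽¹⁾‖` (`frd_eq`). Both norms are square roots of sums of
iid terms, so the law of large numbers gives `gap / √n → √(α κ) - r` in mean square, with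
`κ = E (|a| - |x a + r b|)²` for independent standard normal `a`, `b`. The limit is therefore
`φ₀ = max 0 (√(α κ) - r) ^ 2`.

The primal problem minimizes `‖|A e₁| - |A u|‖` over `u = (x, w)` with `‖w‖ = r` (`frp_eq_fpro`).
Conditionally on the first column `g⁽⁰⁾` the absolute values are a minimum over sign patterns of
`‖B w + b‖` with a deterministic offset `b`, so a form of Gordon's inequality applies:
`min (‖B w + b‖ + r γ)` is stochastically larger than `min (‖r g + b‖ + ⟪w, h⟫)`, with a scalar
Gaussian `γ`. It is proved by Gaussian interpolation (`gaussian_interpolation`) of the function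
`exp (- ∑ i, exp (t - u i))`, a smooth surrogate of the indicator of `∀ i, t ≤ u i`. The sign of the
derivative along the interpolation comes from `(r ^ 2 - ⟪w i, w l⟫) * (1 - ⟪∇u i, ∇u l⟫) ≥ 0`
(`gordon_algebra`). Sharpening the surrogate and passing from finite to dense index sets gives
`gordon_mismatch_add`; the scalar `γ` is removed by restricting to `γ < 0`, at the cost of a
constant factor that is harmless for probabilities tending to `0` (`gordon_mismatch`). So the primal
is at least about `φ₀` with probability tending to `1`, and rotation invariance of the Gaussian
matrix extends this from `e₁` to every unit vector.

For the solvability statement at `c = 1`, uniqueness concerns all `u` at once, not one pair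
`(c, x)`. But `κ ≤ r ^ 2` on the unit sphere (`kappa_le`), so `φ₀ > 0` forces `α > 1` and eventually
there are more measurements than unknowns. Then uniqueness holds almost surely
(`ae_uniquelySolvable`): the first `n` rows are invertible and leave finitely many candidates, one
for each sign pattern, and the independent next row rejects all of them but `± xbar`.
-/

namespace PhaseRetrieval

/-! ### Gaussian integration by parts and interpolation -/

/-- Gaussian integration by parts in one variable, `E[ξ g(ξ)] = E[g'(ξ)]`. -/
theorem integral_id_mul_gaussianReal {g g' : ℝ → ℝ} {C C' : ℝ}
    (hg : ∀ s, HasDerivAt g (g' s) s) (hgC : ∀ s, |g s| ≤ C) (hgC' : ∀ s, |g' s| ≤ C')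
    (hg'c : Continuous g') :
    ∫ s, s * g s ∂(gaussianReal 0 1) = ∫ s, g' s ∂(gaussianReal 0 1) := by
  have hgc : Continuous g := continuous_iff_continuousAt.2 fun s => (hg s).continuousAt
  rw [integral_gaussianReal_eq_integral_smul one_ne_zero,
    integral_gaussianReal_eq_integral_smul one_ne_zero]
  set φ : ℝ → ℝ := gaussianPDFReal 0 1 with hφ
  have hφd : ∀ s, HasDerivAt φ (-s * φ s) s := by
    intro s
    have h1 : HasDerivAt (fun s : ℝ => -(s - 0) ^ 2 / (2 * ((1 : NNReal) : ℝ))) (-s) s := by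
      have := (((hasDerivAt_id s).sub_const 0).pow 2).neg.div_const (2 * ((1 : NNReal) : ℝ))
      refine this.congr_deriv ?_
      simp
      ring
    have h2 := (h1.exp).const_mul ((√(2 * Real.pi * ((1 : NNReal) : ℝ)))⁻¹)
    rw [hφ, gaussianPDFReal_def]
    refine h2.congr_deriv ?_
    ring
  have hφint : Integrable φ := integrable_gaussianPDFReal 0 1
  have hφint' : Integrable fun s => s * φ s := by
    have h : Integrable (fun s : ℝ => s) (gaussianReal 0 1) :=
      (memLp_id_gaussianReal (μ := 0) (v := 1) 1).integrable (by simp)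
    rw [gaussianReal_of_var_ne_zero _ one_ne_zero, integrable_withDensity_iff
      (measurable_gaussianPDF 0 1) (ae_of_all _ fun _ => gaussianPDF_lt_top)] at h
    simpa [toReal_gaussianPDF] using! h
  have hφc : Continuous φ := continuous_iff_continuousAt.2 fun s => (hφd s).continuousAt
  have key := integral_mul_deriv_eq_deriv_mul_of_integrable (u := g) (u' := g') (v := φ)
    (v' := fun s => -s * φ s) (fun s _ => hg s) (fun s _ => hφd s) ?_ ?_ ?_
  · simp only [smul_eq_mul]
    have e1 : ∀ s, φ s * (s * g s) = -(g s * (-s * φ s)) := fun s => by ring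
    simp_rw [e1, integral_neg]
    rw [key, neg_neg]
    exact integral_congr_ae (ae_of_all _ fun s => by ring)
  · have := (hφint'.bdd_mul (c := C) hgc.aestronglyMeasurable (ae_of_all _ hgC)).neg
    refine this.congr (ae_of_all _ fun s => ?_)
    simp
  · exact hφint.bdd_mul (c := C') hg'c.aestronglyMeasurable (ae_of_all _ hgC')
  · exact hφint.bdd_mul (c := C) hgc.aestronglyMeasurable (ae_of_all _ hgC)

/-- Resampling one coordinate of an iid family does not change its law; this isolates that
coordinate without a decomposition of the index type. -/
theorem measurePreserving_update {D : Type*} [Fintype D] [DecidableEq D] (p : D)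
    (ν : Measure ℝ) [IsProbabilityMeasure ν] :
    MeasurePreserving (fun z : (D → ℝ) × ℝ => Function.update z.1 p z.2)
      ((Measure.pi fun _ : D => ν).prod ν) (Measure.pi fun _ : D => ν) := by
  have hmeas : Measurable (fun z : (D → ℝ) × ℝ => Function.update z.1 p z.2) := by
    rw [measurable_pi_iff]
    intro d
    by_cases h : d = p
    · subst h; simpa using measurable_snd
    · simpa [Function.update_of_ne h] using! (measurable_pi_apply d).comp measurable_fst
  refine ⟨hmeas, (Measure.pi_eq fun s hs => ?_).symm⟩
  have hpre : (fun z : (D → ℝ) × ℝ => Function.update z.1 p z.2) ⁻¹' (Set.univ.pi s) =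
      (Set.univ.pi (Function.update s p Set.univ)) ×ˢ (s p) := by
    ext ⟨z, t⟩
    simp only [Set.mem_preimage, Set.mem_pi, Set.mem_univ, true_implies, Set.mem_prod]
    constructor
    · intro h
      refine ⟨fun d => ?_, by simpa using h p⟩
      by_cases hd : d = p
      · subst hd; simp
      · simpa [Function.update_of_ne hd] using h d
    · rintro ⟨h1, h2⟩ d
      by_cases hd : d = p
      · subst hd; simpa using h2
      · simpa [Function.update_of_ne hd] using h1 d
  rw [Measure.map_apply hmeas (MeasurableSet.univ_pi hs), hpre, Measure.prod_prod,
    Measure.pi_pi]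
  rw [← Finset.mul_prod_erase Finset.univ _ (Finset.mem_univ p),
    ← Finset.mul_prod_erase Finset.univ (fun i => ν (s i)) (Finset.mem_univ p)]
  simp only [Function.update_self, measure_univ, one_mul]
  rw [mul_comm]
  congr 1
  refine Finset.prod_congr rfl fun d hd => ?_
  rw [Function.update_of_ne (Finset.ne_of_mem_erase hd)]

theorem integrable_eval_gaussian {D : Type*} [Fintype D] (p : D) :
    Integrable (fun ω : D → ℝ => ω p) (Measure.pi fun _ : D => gaussianReal 0 1) := by
  have h : Integrable (fun s : ℝ => s) (gaussianReal 0 1) :=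
    (memLp_id_gaussianReal (μ := 0) (v := 1) 1).integrable (by simp)
  exact (measurePreserving_eval (fun _ : D => gaussianReal 0 1) p).integrable_comp_of_integrable h

/-- Gaussian integration by parts in one coordinate of a standard normal vector. -/
theorem integral_eval_mul_gaussian {D : Type*} [Fintype D] [DecidableEq D] (p : D)
    {G G' : (D → ℝ) → ℝ} {C C' : ℝ}
    (hG : ∀ ω s, HasDerivAt (fun s => G (Function.update ω p s)) (G' (Function.update ω p s)) s)
    (hGc : Continuous G) (hGc' : Continuous G') (hGC : ∀ ω, |G ω| ≤ C) (hGC' : ∀ ω, |G' ω| ≤ C') :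
    ∫ ω, ω p * G ω ∂(Measure.pi fun _ : D => gaussianReal 0 1) =
      ∫ ω, G' ω ∂(Measure.pi fun _ : D => gaussianReal 0 1) := by
  have hmp := measurePreserving_update p (gaussianReal 0 1)
  have i1 : Integrable (fun ω : D → ℝ => ω p * G ω) (Measure.pi fun _ : D => gaussianReal 0 1) :=
    (integrable_eval_gaussian p).mul_bdd (c := C) hGc.aestronglyMeasurable (ae_of_all _ hGC)
  have i2 : Integrable G' (Measure.pi fun _ : D => gaussianReal 0 1) :=
    Integrable.of_bound hGc'.aestronglyMeasurable C' (ae_of_all _ hGC')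
  have j1 := hmp.integrable_comp_of_integrable i1
  have j2 := hmp.integrable_comp_of_integrable i2
  have e1 := integral_map (μ := (Measure.pi fun _ : D => gaussianReal 0 1).prod (gaussianReal 0 1))
    hmp.measurable.aemeasurable (f := fun ω : D → ℝ => ω p * G ω)
    (by rw [hmp.map_eq]; exact i1.aestronglyMeasurable)
  have e2 := integral_map (μ := (Measure.pi fun _ : D => gaussianReal 0 1).prod (gaussianReal 0 1))
    hmp.measurable.aemeasurable (f := G')
    (by rw [hmp.map_eq]; exact i2.aestronglyMeasurable)
  rw [hmp.map_eq] at e1 e2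
  rw [e1, e2]
  refine (integral_prod _ j1).trans (Eq.trans ?_ (integral_prod _ j2).symm)
  refine integral_congr_ae (ae_of_all _ fun ω => ?_)
  have hupd : Continuous fun s : ℝ => Function.update ω p s :=
    continuous_const.update p continuous_id
  have := integral_id_mul_gaussianReal (hG ω) (fun s => hGC _) (fun s => hGC' _)
    (hGc'.comp hupd)
  simpa using this

/-- Gaussian interpolation. If, at every point, the Hessian `H` of a bounded `C²` function `f` has
a larger trace along the directions `x p` than along the directions `y q`, then
`E f(∑ ξ_p x_p) ≥ E f(∑ η_q y_q)` for independent standard normal `ξ_p`, `η_q`. -/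
theorem gaussian_interpolation {P Q E : Type*} [Fintype P] [Fintype Q]
    [NormedAddCommGroup E] [NormedSpace ℝ E]
    {f : E → ℝ} {f' : E → E →L[ℝ] ℝ} {H : E → E → ℝ} {C₀ C₁ : ℝ}
    (hf : ∀ z, HasFDerivAt f (f' z) z) (hf' : Continuous f')
    (hC₀ : ∀ z, |f z| ≤ C₀) (hC₁ : ∀ z, ‖f' z‖ ≤ C₁)
    (hH : ∀ z v, HasDerivAt (fun τ : ℝ => f' (z + τ • v) v) (H z v) 0)
    (hHc : ∀ v, Continuous fun z => H z v) (hHb : ∀ v, ∃ K, ∀ z, |H z v| ≤ K)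
    (x : P → E) (y : Q → E) (hxy : ∀ z, ∑ q, H z (y q) ≤ ∑ p, H z (x p)) :
    ∫ ω, f (∑ q, ω (Sum.inr q) • y q) ∂(Measure.pi fun _ : P ⊕ Q => gaussianReal 0 1) ≤
      ∫ ω, f (∑ p, ω (Sum.inl p) • x p) ∂(Measure.pi fun _ : P ⊕ Q => gaussianReal 0 1) := by
  classical
  set μ : Measure (P ⊕ Q → ℝ) := Measure.pi fun _ => gaussianReal 0 1 with hμ
  -- The path `Z θ = sin θ • ∑ ξ_p x_p + cos θ • ∑ η_q y_q`, from `θ = 0` to `θ = π / 2`.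
  let e : P ⊕ Q → E := Sum.elim x y
  let a : ℝ → P ⊕ Q → ℝ := fun θ => Sum.elim (fun _ => Real.sin θ) (fun _ => Real.cos θ)
  let a' : ℝ → P ⊕ Q → ℝ := fun θ => Sum.elim (fun _ => Real.cos θ) (fun _ => -Real.sin θ)
  have ha : ∀ θ d, HasDerivAt (fun θ => a θ d) (a' θ d) θ := by
    rintro θ (p | q)
    · exact Real.hasDerivAt_sin θ
    · exact Real.hasDerivAt_cos θ
  have ha'1 : ∀ θ d, |a' θ d| ≤ 1 := by
    rintro θ (p | q)
    · exact Real.abs_cos_le_one θ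
    · simpa [a'] using Real.abs_sin_le_one θ
  let Z : ℝ → (P ⊕ Q → ℝ) → E := fun θ ω => ∑ d, ω d • (a θ d • e d)
  have hfc : Continuous f := continuous_iff_continuousAt.2 fun z => (hf z).continuousAt
  have hZc : ∀ θ, Continuous (Z θ) := fun θ => by fun_prop
  have hZd : ∀ θ ω, HasDerivAt (fun θ => Z θ ω) (∑ d, ω d • (a' θ d • e d)) θ := by
    intro θ ω
    exact HasDerivAt.fun_sum fun d _ => ((ha θ d).smul_const (e d)).const_smul (ω d)
  have hC₁0 : 0 ≤ C₁ := (norm_nonneg _).trans (hC₁ 0)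
  have hF : ∀ θ, HasDerivAt (fun θ => ∫ ω, f (Z θ ω) ∂μ)
      (∫ ω, f' (Z θ ω) (∑ d, ω d • (a' θ d • e d)) ∂μ) θ := by
    intro θ
    refine (hasDerivAt_integral_of_dominated_loc_of_deriv_le (μ := μ) (s := Set.univ) (x₀ := θ)
      (F := fun θ ω => f (Z θ ω)) (F' := fun θ ω => f' (Z θ ω) (∑ d, ω d • (a' θ d • e d)))
      (bound := fun ω : P ⊕ Q → ℝ => C₁ * ∑ d, |ω d| * ‖e d‖) Filter.univ_mem ?_ ?_ ?_ ?_ ?_ ?_).2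
    · exact Eventually.of_forall fun θ => (hfc.comp (hZc θ)).aestronglyMeasurable
    · exact Integrable.of_bound (hfc.comp (hZc θ)).aestronglyMeasurable C₀
        (ae_of_all _ fun ω => hC₀ _)
    · have : Continuous fun ω => f' (Z θ ω) (∑ d, ω d • (a' θ d • e d)) :=
        (hf'.comp (hZc θ)).clm_apply (by fun_prop)
      exact this.aestronglyMeasurable
    · refine ae_of_all _ fun ω θ _ => ?_
      refine ((f' (Z θ ω)).le_opNorm _).trans ?_
      refine mul_le_mul (hC₁ _) ((norm_sum_le _ _).trans (Finset.sum_le_sum fun d _ => ?_))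
        (norm_nonneg _) hC₁0
      rw [norm_smul, norm_smul, Real.norm_eq_abs, Real.norm_eq_abs]
      exact mul_le_mul_of_nonneg_left
        (mul_le_of_le_one_left (norm_nonneg _) (ha'1 θ d)) (abs_nonneg _)
    · exact (integrable_finsetSum _ fun d _ =>
        (integrable_eval_gaussian d).abs.mul_const _).const_mul _
    · refine ae_of_all _ fun ω θ _ => ?_
      exact (hf (Z θ ω)).comp_hasDerivAt θ (hZd θ ω)
  have hIBP : ∀ θ d, ∫ ω, ω d * f' (Z θ ω) (e d) ∂μ = a θ d * ∫ ω, H (Z θ ω) (e d) ∂μ := by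
    intro θ d
    obtain ⟨K, hK⟩ := hHb (e d)
    rw [← integral_const_mul]
    have hcont : Continuous fun ω => f' (Z θ ω) (e d) :=
      (hf'.comp (hZc θ)).clm_apply continuous_const
    refine integral_eval_mul_gaussian d (C := C₁ * ‖e d‖) (C' := |a θ d| * K) ?_
      hcont (continuous_const.mul ((hHc _).comp (hZc θ))) ?_ ?_
    · intro ω s
      have hZu : ∀ t, Z θ (Function.update ω d t) =
          Z θ (Function.update ω d s) + ((t - s) * a θ d) • e d := by
        intro t
        simp only [Z]
        rw [← Finset.add_sum_erase Finset.univ _ (Finset.mem_univ d),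
          ← Finset.add_sum_erase Finset.univ
            (fun d' => Function.update ω d s d' • (a θ d' • e d')) (Finset.mem_univ d)]
        have : ∀ t, ∑ d' ∈ Finset.univ.erase d, Function.update ω d t d' • (a θ d' • e d') =
            ∑ d' ∈ Finset.univ.erase d, ω d' • (a θ d' • e d') := fun t =>
          Finset.sum_congr rfl fun d' hd' => by
            rw [Function.update_of_ne (Finset.ne_of_mem_erase hd')]
        rw [this, this]
        simp only [Function.update_self, smul_smul, sub_mul, sub_smul]
        abel
      have hZu' : (fun t => f' (Z θ (Function.update ω d t)) (e d)) = fun t =>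
          f' (Z θ (Function.update ω d s) + ((t - s) * a θ d) • e d) (e d) :=
        funext fun t => by rw [hZu t]
      rw [hZu']
      have hlin : HasDerivAt (fun t : ℝ => (t - s) * a θ d) (a θ d) s := by
        simpa using ((hasDerivAt_id s).sub_const s).mul_const (a θ d)
      have hH0 := hH (Z θ (Function.update ω d s)) (e d)
      have hH1 : HasDerivAt (fun τ : ℝ => f' (Z θ (Function.update ω d s) + τ • e d) (e d))
          (H (Z θ (Function.update ω d s)) (e d)) ((s - s) * a θ d) := by simpa using hH0
      have := hH1.comp s hlin
      simpa [mul_comm] using! this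
    · intro ω
      exact ((f' (Z θ ω)).le_opNorm _).trans (mul_le_mul_of_nonneg_right (hC₁ _) (norm_nonneg _))
    · intro ω
      rw [abs_mul]
      exact mul_le_mul_of_nonneg_left (hK _) (abs_nonneg _)
  -- Integration by parts turns the derivative along the path into the difference of the traces.
  have hF' : ∀ θ, ∫ ω, f' (Z θ ω) (∑ d, ω d • (a' θ d • e d)) ∂μ =
      Real.sin θ * Real.cos θ * ∫ ω, (∑ p, H (Z θ ω) (x p) - ∑ q, H (Z θ ω) (y q)) ∂μ := by
    intro θ
    have hHi : ∀ v, Integrable (fun ω => H (Z θ ω) v) μ := fun v => by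
      obtain ⟨K, hK⟩ := hHb v
      exact Integrable.of_bound ((hHc v).comp (hZc θ)).aestronglyMeasurable K
        (ae_of_all _ fun ω => hK _)
    have h1 : ∀ ω, f' (Z θ ω) (∑ d, ω d • (a' θ d • e d)) =
        ∑ d, a' θ d * (ω d * f' (Z θ ω) (e d)) := fun ω => by
      rw [map_sum]
      refine Finset.sum_congr rfl fun d _ => ?_
      simp only [map_smul, smul_eq_mul]
      ring
    simp_rw [h1]
    rw [integral_finsetSum]
    · simp_rw [integral_const_mul, hIBP]
      rw [integral_sub (integrable_finsetSum _ fun p _ => hHi _)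
        (integrable_finsetSum _ fun p _ => hHi _), integral_finsetSum _ fun p _ => hHi _,
        integral_finsetSum _ fun p _ => hHi _, Fintype.sum_sum_type]
      simp only [a, a', e, Sum.elim_inl, Sum.elim_inr]
      rw [mul_sub, Finset.mul_sum, Finset.mul_sum, sub_eq_add_neg, ← Finset.sum_neg_distrib]
      congr 1 <;> exact Finset.sum_congr rfl fun _ _ => by ring
    · intro d _
      have hcont : Continuous fun ω => f' (Z θ ω) (e d) :=
        (hf'.comp (hZc θ)).clm_apply continuous_const
      refine (((integrable_eval_gaussian d).mul_bdd (c := C₁ * ‖e d‖) hcont.aestronglyMeasurable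
        (ae_of_all _ fun ω => ?_))).const_mul _
      exact ((f' (Z θ ω)).le_opNorm _).trans (mul_le_mul_of_nonneg_right (hC₁ _) (norm_nonneg _))
  have hmono : MonotoneOn (fun θ => ∫ ω, f (Z θ ω) ∂μ) (Set.Icc 0 (Real.pi / 2)) := by
    refine monotoneOn_of_hasDerivWithinAt_nonneg (convex_Icc _ _)
      (fun θ _ => (hF θ).continuousAt.continuousWithinAt)
      (fun θ _ => (hF θ).hasDerivWithinAt) ?_
    intro θ hθ
    rw [interior_Icc] at hθ
    rw [hF']
    refine mul_nonneg (mul_nonneg (Real.sin_nonneg_of_nonneg_of_le_pi hθ.1.le ?_)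
      (Real.cos_nonneg_of_mem_Icc ⟨?_, hθ.2.le⟩)) (integral_nonneg fun ω => sub_nonneg.2 (hxy _))
    · linarith [hθ.2, Real.pi_pos]
    · linarith [hθ.1, Real.pi_pos]
  have hpi := Real.pi_pos
  have := hmono (Set.left_mem_Icc.2 (by positivity)) (Set.right_mem_Icc.2 (by positivity))
    (by positivity)
  simpa [Z, a, e, Fintype.sum_sum_type] using this

/-! ### The comparison inequality for matrix processes -/

theorem integral_comp_of_measurePreserving {X Y : Type*} [MeasurableSpace X] [MeasurableSpace Y]
    {μ : Measure X} {ν : Measure Y} {T : X → Y} (hT : MeasurePreserving T μ ν)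
    {f : Y → ℝ} (hf : AEStronglyMeasurable f ν) : ∫ x, f (T x) ∂μ = ∫ y, f y ∂ν := by
  rw [← hT.map_eq, integral_map hT.measurable.aemeasurable (by rwa [hT.map_eq])]

theorem measurePreserving_curry_gaussMatrix (m k : ℕ) :
    MeasurePreserving (fun (ω : Fin m × Fin k → ℝ) i j => ω (i, j))
      (Measure.pi fun _ => gaussianReal 0 1) (gaussMatrix m k) := by
  have hm : Measurable (fun (A : Fin m → Fin k → ℝ) (p : Fin m × Fin k) => A p.1 p.2) := by
    fun_prop
  have h : MeasurePreserving (fun (A : Fin m → Fin k → ℝ) (p : Fin m × Fin k) => A p.1 p.2)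
      (gaussMatrix m k) (Measure.pi fun _ => gaussianReal 0 1) := by
    refine ⟨hm, (Measure.pi_eq fun s hs => ?_).symm⟩
    rw [Measure.map_apply hm (MeasurableSet.univ_pi hs)]
    have : (fun (A : Fin m → Fin k → ℝ) (p : Fin m × Fin k) => A p.1 p.2) ⁻¹' Set.univ.pi s =
        Set.univ.pi fun i => Set.univ.pi fun j => s (i, j) := by
      ext A
      simp [Set.mem_pi]
    rw [this, gaussMatrix, Measure.pi_pi]
    simp_rw [Measure.pi_pi]
    rw [Fintype.prod_prod_type]
  exact h.symm (MeasurableEquiv.curry (Fin m) (Fin k) ℝ).symm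

/-- The algebraic heart of Gordon's comparison: the difference of the two sides is
`∑ i l, p i * p l * (R ^ 2 - ⟪w i, w l⟫) * (1 - ⟪g i, g l⟫)`, and both factors are nonnegative. -/
theorem gordon_algebra {ι : Type*} [Fintype ι] {m k : ℕ} {R : ℝ} {p : ι → ℝ} (hp : ∀ i, 0 ≤ p i)
    {g : ι → Fin m → ℝ} (hg : ∀ i, ∑ a, g i a ^ 2 ≤ 1)
    {w : ι → Fin k → ℝ} (hw : ∀ i, ∑ j, w i j ^ 2 = R ^ 2) :
    ∑ a, (∑ i, p i * (g i a * R)) ^ 2 + ∑ j, (∑ i, p i * w i j) ^ 2 ≤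
      ∑ a, ∑ j, (∑ i, p i * (g i a * w i j)) ^ 2 + (∑ i, p i * R) ^ 2 := by
  have key : ∑ a, ∑ j, (∑ i, p i * (g i a * w i j)) ^ 2 + (∑ i, p i * R) ^ 2 -
      (∑ a, (∑ i, p i * (g i a * R)) ^ 2 + ∑ j, (∑ i, p i * w i j) ^ 2) =
      ∑ i, ∑ l, p i * p l * ((R ^ 2 - ∑ j, w i j * w l j) * (1 - ∑ a, g i a * g l a)) := by
    have e1 : ∑ a, ∑ j, (∑ i, p i * (g i a * w i j)) ^ 2 =
        ∑ i, ∑ l, p i * p l * ((∑ j, w i j * w l j) * ∑ a, g i a * g l a) := by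
      simp_rw [sq, Finset.sum_mul_sum, Finset.mul_sum]
      simp_rw [Finset.sum_comm (s := (Finset.univ : Finset (Fin k)))
        (t := (Finset.univ : Finset ι))]
      simp_rw [Finset.sum_comm (s := (Finset.univ : Finset (Fin m)))
        (t := (Finset.univ : Finset ι))]
      refine Finset.sum_congr rfl fun i _ => Finset.sum_congr rfl fun l _ => ?_
      rw [Finset.sum_comm]
      refine Finset.sum_congr rfl fun j _ => Finset.sum_congr rfl fun a _ => ?_
      ring
    have e2 : (∑ i, p i * R) ^ 2 = ∑ i, ∑ l, p i * p l * R ^ 2 := by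
      rw [sq, Finset.sum_mul_sum]
      exact Finset.sum_congr rfl fun i _ => Finset.sum_congr rfl fun l _ => by ring
    have e3 : ∑ a, (∑ i, p i * (g i a * R)) ^ 2 =
        ∑ i, ∑ l, p i * p l * (R ^ 2 * ∑ a, g i a * g l a) := by
      simp_rw [sq, Finset.sum_mul_sum, Finset.mul_sum]
      simp_rw [Finset.sum_comm (s := (Finset.univ : Finset (Fin m)))
        (t := (Finset.univ : Finset ι))]
      exact Finset.sum_congr rfl fun i _ => Finset.sum_congr rfl fun l _ =>
        Finset.sum_congr rfl fun a _ => by ring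
    have e4 : ∑ j, (∑ i, p i * w i j) ^ 2 = ∑ i, ∑ l, p i * p l * ∑ j, w i j * w l j := by
      simp_rw [sq, Finset.sum_mul_sum, Finset.mul_sum]
      simp_rw [Finset.sum_comm (s := (Finset.univ : Finset (Fin k)))
        (t := (Finset.univ : Finset ι))]
      exact Finset.sum_congr rfl fun i _ => Finset.sum_congr rfl fun l _ =>
        Finset.sum_congr rfl fun a _ => by ring
    rw [e1, e2, e3, e4]
    simp_rw [← Finset.sum_add_distrib, ← Finset.sum_sub_distrib]
    exact Finset.sum_congr rfl fun i _ => Finset.sum_congr rfl fun l _ => by ring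
  have hpos : 0 ≤ ∑ i, ∑ l,
      p i * p l * ((R ^ 2 - ∑ j, w i j * w l j) * (1 - ∑ a, g i a * g l a)) := by
    refine Finset.sum_nonneg fun i _ => Finset.sum_nonneg fun l _ =>
      mul_nonneg (mul_nonneg (hp i) (hp l)) (mul_nonneg ?_ ?_)
    · have : ∑ j, w i j * w l j ≤ ∑ j, (w i j ^ 2 + w l j ^ 2) / 2 :=
        Finset.sum_le_sum fun j _ => by nlinarith [sq_nonneg (w i j - w l j)]
      rw [← Finset.sum_div, Finset.sum_add_distrib, hw, hw] at this
      linarith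
    · have : ∑ a, g i a * g l a ≤ ∑ a, (g i a ^ 2 + g l a ^ 2) / 2 :=
        Finset.sum_le_sum fun j _ => by nlinarith [sq_nonneg (g i j - g l j)]
      rw [← Finset.sum_div, Finset.sum_add_distrib] at this
      linarith [hg i, hg l]
  linarith

section SoftMin

variable {ι : Type*} {m k : ℕ} (b : ι → Fin m → ℝ) (t : ℝ)

/-- The smoothed length `√(1 + ‖V + b‖²)` of the `i`-th vector. -/
noncomputable def softLen (i : ι) (z : (ι → Fin m → ℝ) × (ι → ℝ)) : ℝ :=
  √(1 + ∑ a, (z.1 i a + b i a) ^ 2)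

/-- The weight `exp (t - u i)` of the index `i`, with `u i` the smoothed length of the `i`-th vector
plus the `i`-th scalar. -/
noncomputable def softWeight (i : ι) (z : (ι → Fin m → ℝ) × (ι → ℝ)) : ℝ :=
  Real.exp (t - softLen b i z - z.2 i)

/-- The derivative in the direction `v` of the `i`-th value `u i`. -/
noncomputable def softSlope (i : ι) (z v : (ι → Fin m → ℝ) × (ι → ℝ)) : ℝ :=
  (∑ a, (z.1 i a + b i a) * v.1 i a) / softLen b i z + v.2 i

theorem one_le_softLen (i : ι) (z) : 1 ≤ softLen b i z := by
  rw [softLen, Real.one_le_sqrt]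
  linarith [Finset.sum_nonneg fun (a : Fin m) (_ : a ∈ Finset.univ) =>
    sq_nonneg (z.1 i a + b i a)]

theorem softLen_sq (i : ι) (z) : softLen b i z ^ 2 = 1 + ∑ a, (z.1 i a + b i a) ^ 2 :=
  Real.sq_sqrt (by positivity)

theorem softWeight_nonneg (i : ι) (z) : 0 ≤ softWeight b t i z := (Real.exp_pos _).le

theorem hasDerivAt_sum_coord (i : ι) (z v : (ι → Fin m → ℝ) × (ι → ℝ)) :
    HasDerivAt (fun τ : ℝ => ∑ a, ((z + τ • v).1 i a + b i a) * v.1 i a) (∑ a, v.1 i a ^ 2) 0 := by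
  refine HasDerivAt.fun_sum fun a _ => ?_
  have h1 : HasDerivAt (fun τ : ℝ => (z + τ • v).1 i a + b i a) (v.1 i a) 0 := by
    simpa using (((hasDerivAt_id (0 : ℝ)).mul_const (v.1 i a)).const_add (z.1 i a)).add_const
      (b i a)
  simpa [sq] using h1.mul_const (v.1 i a)

theorem hasDerivAt_softLen (i : ι) (z v : (ι → Fin m → ℝ) × (ι → ℝ)) :
    HasDerivAt (fun τ : ℝ => softLen b i (z + τ • v))
      ((∑ a, (z.1 i a + b i a) * v.1 i a) / softLen b i z) 0 := by
  have h0 : HasDerivAt (fun τ : ℝ => 1 + ∑ a, ((z + τ • v).1 i a + b i a) ^ 2)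
      (∑ a, 2 * (z.1 i a + b i a) * v.1 i a) 0 := by
    refine (HasDerivAt.fun_sum fun a _ => ?_).const_add 1
    have h1 : HasDerivAt (fun τ : ℝ => (z + τ • v).1 i a + b i a) (v.1 i a) 0 := by
      simpa using (((hasDerivAt_id (0 : ℝ)).mul_const (v.1 i a)).const_add (z.1 i a)).add_const
        (b i a)
    simpa using h1.fun_pow 2
  have h2 := h0.sqrt (by positivity)
  refine h2.congr_deriv ?_
  simp only [softLen, zero_smul, add_zero]
  simp_rw [mul_assoc]
  rw [← Finset.mul_sum, mul_div_mul_left _ _ two_ne_zero]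

theorem hasDerivAt_softWeight (i : ι) (z v : (ι → Fin m → ℝ) × (ι → ℝ)) :
    HasDerivAt (fun τ : ℝ => softWeight b t i (z + τ • v))
      (-(softWeight b t i z * softSlope b i z v)) 0 := by
  have h1 : HasDerivAt (fun τ : ℝ => (z + τ • v).2 i) (v.2 i) 0 := by
    simpa using ((hasDerivAt_id (0 : ℝ)).mul_const (v.2 i)).const_add (z.2 i)
  have := (((hasDerivAt_softLen b i z v).const_sub t).sub h1).exp
  refine this.congr_deriv ?_
  simp only [softWeight, softSlope, Pi.sub_apply, zero_smul, add_zero]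
  ring

theorem hasDerivAt_softSlope (i : ι) (z v : (ι → Fin m → ℝ) × (ι → ℝ)) :
    HasDerivAt (fun τ : ℝ => softSlope b i (z + τ • v) v) ((∑ a, v.1 i a ^ 2) / softLen b i z -
      (∑ a, (z.1 i a + b i a) * v.1 i a) ^ 2 / softLen b i z ^ 3) 0 := by
  have hpos : softLen b i z ≠ 0 := (zero_lt_one.trans_le (one_le_softLen b i z)).ne'
  have := ((hasDerivAt_sum_coord b i z v).fun_div (hasDerivAt_softLen b i z v)
    (by simpa using hpos)).add_const (v.2 i)
  refine this.congr_deriv ?_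
  simp only [zero_smul, add_zero]
  field_simp

variable [Fintype ι]

/-- A smooth surrogate of the indicator of `∀ i, t ≤ u i`, namely `exp (- ∑ i, exp (t - u i))`. -/
noncomputable def softInd (z : (ι → Fin m → ℝ) × (ι → ℝ)) : ℝ :=
  Real.exp (-∑ i, softWeight b t i z)

/-- The second derivative of `softInd` in the direction `v`. -/
noncomputable def softHess (z v : (ι → Fin m → ℝ) × (ι → ℝ)) : ℝ :=
  softInd b t z * ((∑ i, softWeight b t i z * softSlope b i z v) ^ 2 +
    ∑ i, softWeight b t i z * ((∑ a, v.1 i a ^ 2) / softLen b i z -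
      (∑ a, (z.1 i a + b i a) * v.1 i a) ^ 2 / softLen b i z ^ 3 - softSlope b i z v ^ 2))

theorem contDiff_softLen (i : ι) : ContDiff ℝ 2 (softLen b i) := by
  unfold softLen
  refine ContDiff.sqrt ?_ fun z => ?_
  · fun_prop
  · positivity

theorem contDiff_softWeight (i : ι) : ContDiff ℝ 2 (softWeight b t i) := by
  have := contDiff_softLen b i
  unfold softWeight
  fun_prop

theorem contDiff_softInd : ContDiff ℝ 2 (softInd b t) := by
  have := contDiff_softWeight b t
  unfold softInd
  fun_prop

theorem hasDerivAt_softInd (z v : (ι → Fin m → ℝ) × (ι → ℝ)) :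
    HasDerivAt (fun τ : ℝ => softInd b t (z + τ • v))
      (softInd b t z * ∑ i, softWeight b t i z * softSlope b i z v) 0 := by
  have := (HasDerivAt.fun_sum fun i (_ : i ∈ Finset.univ) =>
    hasDerivAt_softWeight b t i z v).fun_neg.exp
  refine this.congr_deriv ?_
  simp [softInd]

theorem fderiv_softInd_apply (z v : (ι → Fin m → ℝ) × (ι → ℝ)) :
    fderiv ℝ (softInd b t) z v =
      softInd b t z * ∑ i, softWeight b t i z * softSlope b i z v := by
  have h1 : HasFDerivAt (softInd b t) (fderiv ℝ (softInd b t) z) (z + (0 : ℝ) • v) := by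
    simpa using ((contDiff_softInd b t).differentiable (by norm_num) z).hasFDerivAt
  have h2 : HasDerivAt (fun τ : ℝ => z + τ • v) v 0 := by
    simpa using ((hasDerivAt_id (0 : ℝ)).smul_const v).const_add z
  have h3 := HasFDerivAt.comp_hasDerivAt (f := fun τ : ℝ => z + τ • v) (0 : ℝ) h1 h2
  exact h3.unique (hasDerivAt_softInd b t z v)

theorem hasDerivAt_fderiv_softInd (z v : (ι → Fin m → ℝ) × (ι → ℝ)) :
    HasDerivAt (fun τ : ℝ => fderiv ℝ (softInd b t) (z + τ • v) v) (softHess b t z v) 0 := by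
  simp_rw [fderiv_softInd_apply]
  have := (hasDerivAt_softInd b t z v).fun_mul (HasDerivAt.fun_sum fun i (_ : i ∈ Finset.univ) =>
    (hasDerivAt_softWeight b t i z v).fun_mul (hasDerivAt_softSlope b i z v))
  refine this.congr_deriv ?_
  simp only [zero_smul, add_zero, softHess]
  rw [mul_assoc, ← sq, ← mul_add]
  congr 2
  exact Finset.sum_congr rfl fun i _ => by ring

theorem softInd_nonneg (z) : 0 ≤ softInd b t z := (Real.exp_pos _).le

theorem softInd_le_one (z) : softInd b t z ≤ 1 :=
  Real.exp_le_one_iff.2 (neg_nonpos.2 (Finset.sum_nonneg fun i _ => softWeight_nonneg b t i z))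

theorem softInd_mul_sum_le (z) : softInd b t z * ∑ i, softWeight b t i z ≤ 1 := by
  rw [softInd, Real.exp_neg, inv_mul_le_iff₀ (Real.exp_pos _)]
  linarith [Real.add_one_le_exp (∑ i, softWeight b t i z)]

theorem softInd_mul_sum_sq_le (z) : softInd b t z * (∑ i, softWeight b t i z) ^ 2 ≤ 2 := by
  rw [softInd, Real.exp_neg, inv_mul_le_iff₀ (Real.exp_pos _)]
  have hS : 0 ≤ ∑ i, softWeight b t i z :=
    Finset.sum_nonneg fun i _ => softWeight_nonneg b t i z
  linarith [Real.quadratic_le_exp_of_nonneg hS]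

theorem abs_sum_coord_le (i : ι) (z v : (ι → Fin m → ℝ) × (ι → ℝ)) :
    |∑ a, (z.1 i a + b i a) * v.1 i a| ≤ softLen b i z * (m * ‖v‖) := by
  refine (Finset.abs_sum_le_sum_abs _ _).trans ?_
  have : ∀ a ∈ Finset.univ, |(z.1 i a + b i a) * v.1 i a| ≤ softLen b i z * ‖v‖ := by
    intro a _
    rw [abs_mul]
    refine mul_le_mul ?_ ?_ (abs_nonneg _) (zero_le_one.trans (one_le_softLen b i z))
    · refine Real.abs_le_sqrt ?_
      have := Finset.single_le_sum (f := fun a => (z.1 i a + b i a) ^ 2)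
        (fun a _ => sq_nonneg _) (Finset.mem_univ a)
      linarith
    · exact ((norm_le_pi_norm (v.1 i) a).trans (norm_le_pi_norm v.1 i)).trans (norm_fst_le v)
  refine (Finset.sum_le_sum this).trans ?_
  simp
  linarith

theorem abs_softSlope_le (i : ι) (z v : (ι → Fin m → ℝ) × (ι → ℝ)) :
    |softSlope b i z v| ≤ (m + 1) * ‖v‖ := by
  have hpos : 0 < softLen b i z := zero_lt_one.trans_le (one_le_softLen b i z)
  refine (abs_add_le _ _).trans ?_
  rw [abs_div, abs_of_pos hpos, add_mul, one_mul]
  refine add_le_add ?_ ((norm_le_pi_norm v.2 i).trans (norm_snd_le v))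
  rw [div_le_iff₀' hpos]
  exact abs_sum_coord_le b i z v

theorem norm_fderiv_softInd_le (z) : ‖fderiv ℝ (softInd b t) z‖ ≤ m + 1 := by
  refine ContinuousLinearMap.opNorm_le_bound _ (by positivity) fun v => ?_
  rw [fderiv_softInd_apply, Real.norm_eq_abs, abs_mul, abs_of_nonneg (softInd_nonneg b t z)]
  have h1 : |∑ i, softWeight b t i z * softSlope b i z v| ≤
      (∑ i, softWeight b t i z) * ((m + 1) * ‖v‖) := by
    rw [Finset.sum_mul]
    refine (Finset.abs_sum_le_sum_abs _ _).trans (Finset.sum_le_sum fun i _ => ?_)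
    rw [abs_mul, abs_of_nonneg (softWeight_nonneg b t i z)]
    exact mul_le_mul_of_nonneg_left (abs_softSlope_le b i z v) (softWeight_nonneg b t i z)
  refine (mul_le_mul_of_nonneg_left h1 (softInd_nonneg b t z)).trans ?_
  rw [← mul_assoc]
  exact mul_le_of_le_one_left (by positivity) (softInd_mul_sum_le b t z)

theorem abs_softHess_le (z v : (ι → Fin m → ℝ) × (ι → ℝ)) :
    |softHess b t z v| ≤ 2 * ((m + 1) * ‖v‖) ^ 2 +
      (m * ‖v‖ ^ 2 + (m * ‖v‖) ^ 2 + ((m + 1) * ‖v‖) ^ 2) := by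
  have hS : 0 ≤ ∑ i, softWeight b t i z :=
    Finset.sum_nonneg fun i _ => softWeight_nonneg b t i z
  have h1 : |∑ i, softWeight b t i z * softSlope b i z v| ≤
      (∑ i, softWeight b t i z) * ((m + 1) * ‖v‖) := by
    rw [Finset.sum_mul]
    refine (Finset.abs_sum_le_sum_abs _ _).trans (Finset.sum_le_sum fun i _ => ?_)
    rw [abs_mul, abs_of_nonneg (softWeight_nonneg b t i z)]
    exact mul_le_mul_of_nonneg_left (abs_softSlope_le b i z v) (softWeight_nonneg b t i z)
  have h2 : |∑ i, softWeight b t i z * ((∑ a, v.1 i a ^ 2) / softLen b i z -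
      (∑ a, (z.1 i a + b i a) * v.1 i a) ^ 2 / softLen b i z ^ 3 - softSlope b i z v ^ 2)| ≤
      (∑ i, softWeight b t i z) *
        (m * ‖v‖ ^ 2 + (m * ‖v‖) ^ 2 + ((m + 1) * ‖v‖) ^ 2) := by
    rw [Finset.sum_mul]
    refine (Finset.abs_sum_le_sum_abs _ _).trans (Finset.sum_le_sum fun i _ => ?_)
    rw [abs_mul, abs_of_nonneg (softWeight_nonneg b t i z)]
    refine mul_le_mul_of_nonneg_left ?_ (softWeight_nonneg b t i z)
    have hq := one_le_softLen b i z
    have hpos : 0 < softLen b i z := zero_lt_one.trans_le hq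
    refine (abs_sub _ _).trans (add_le_add ((abs_sub _ _).trans (add_le_add ?_ ?_)) ?_)
    · rw [abs_of_nonneg (by positivity)]
      refine (div_le_self (by positivity) hq).trans ?_
      have : ∀ a ∈ Finset.univ, v.1 i a ^ 2 ≤ ‖v‖ ^ 2 := fun a _ => by
        rw [← sq_abs]
        exact pow_le_pow_left₀ (abs_nonneg _)
          (((norm_le_pi_norm (v.1 i) a).trans (norm_le_pi_norm v.1 i)).trans (norm_fst_le v)) 2
      refine (Finset.sum_le_sum this).trans ?_
      simp
    · rw [abs_of_nonneg (by positivity), div_le_iff₀ (by positivity), ← sq_abs]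
      refine (pow_le_pow_left₀ (abs_nonneg _) (abs_sum_coord_le b i z v) 2).trans ?_
      rw [mul_pow, mul_comm]
      refine mul_le_mul_of_nonneg_left (pow_le_pow_right₀ hq (by norm_num)) (by positivity)
    · rw [abs_of_nonneg (by positivity), ← sq_abs]
      exact pow_le_pow_left₀ (abs_nonneg _) (abs_softSlope_le b i z v) 2
  rw [softHess, abs_mul, abs_of_nonneg (softInd_nonneg b t z)]
  refine (mul_le_mul_of_nonneg_left (abs_add_le _ _) (softInd_nonneg b t z)).trans ?_
  rw [mul_add]
  refine add_le_add ?_ ?_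
  · rw [abs_pow]
    refine (mul_le_mul_of_nonneg_left (pow_le_pow_left₀ (abs_nonneg _) h1 2)
      (softInd_nonneg b t z)).trans ?_
    rw [mul_pow, ← mul_assoc]
    exact mul_le_mul_of_nonneg_right (softInd_mul_sum_sq_le b t z) (by positivity)
  · refine (mul_le_mul_of_nonneg_left h2 (softInd_nonneg b t z)).trans ?_
    rw [← mul_assoc]
    exact mul_le_of_le_one_left (by positivity) (softInd_mul_sum_le b t z)

theorem continuous_softHess (v : (ι → Fin m → ℝ) × (ι → ℝ)) :
    Continuous fun z => softHess b t z v := by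
  have h1 : Continuous (softInd b t) := (contDiff_softInd b t).continuous
  have h2 : ∀ i, Continuous (softWeight b t i) := fun i => (contDiff_softWeight b t i).continuous
  have h3 : ∀ i, Continuous (softLen b i) := fun i => (contDiff_softLen b i).continuous
  have h4 : ∀ i z, softLen b i z ≠ 0 := fun i z =>
    (zero_lt_one.trans_le (one_le_softLen b i z)).ne'
  have h5 : ∀ i, Continuous fun z => softSlope b i z v := fun i => by
    unfold softSlope
    exact (Continuous.div (by fun_prop) (h3 i) (h4 i)).add continuous_const
  unfold softHess
  refine h1.mul (Continuous.add (by fun_prop) (continuous_finsetSum _ fun i _ =>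
    (h2 i).mul (((continuous_const.div (h3 i) (h4 i)).sub
      (Continuous.div (by fun_prop) ((h3 i).pow 3) fun z => pow_ne_zero 3 (h4 i z))).sub
        ((h5 i).pow 2))))

/-- The coordinate directions of `(A w_i, R γ)_i`, indexed by the entries of `A` and by `γ`. -/
def primalDir (R : ℝ) (w : ι → Fin k → ℝ) :
    (Fin m × Fin k) ⊕ Unit → (ι → Fin m → ℝ) × (ι → ℝ) :=
  Sum.elim (fun q => (fun i => Pi.single q.1 (w i q.2), 0)) (fun _ => (0, fun _ => R))

/-- The coordinate directions of `(R g, ⟪h, w_i⟫)_i`, indexed by the entries of `g` and `h`. -/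
def dualDir (R : ℝ) (w : ι → Fin k → ℝ) : Fin m ⊕ Fin k → (ι → Fin m → ℝ) × (ι → ℝ) :=
  Sum.elim (fun a => (fun _ => Pi.single a R, 0)) (fun j => (0, fun i => w i j))

/-- The hypothesis of `gaussian_interpolation` for `softInd`. The second-order terms of the
individual `u i` cancel because all `w i` have the same norm `R`, and the products of first-order
terms are compared by `gordon_algebra`. -/
theorem sum_softHess_le {R : ℝ} {w : ι → Fin k → ℝ} (hw : ∀ i, ∑ j, w i j ^ 2 = R ^ 2)
    (z : (ι → Fin m → ℝ) × (ι → ℝ)) :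
    ∑ q, softHess b t z (dualDir R w q) ≤ ∑ p, softHess b t z (primalDir R w p) := by
  have hsingle : ∀ (i : ι) (a : Fin m) (r : ℝ),
      ∑ a', (z.1 i a' + b i a') * (Pi.single a r : Fin m → ℝ) a' = (z.1 i a + b i a) * r := by
    intro i a r
    rw [Finset.sum_eq_single a]
    · simp
    · intro a' _ h; simp [Pi.single_eq_of_ne h]
    · simp
  have hsingle2 : ∀ (a : Fin m) (r : ℝ), ∑ a', (Pi.single a r : Fin m → ℝ) a' ^ 2 = r ^ 2 := by
    intro a r
    rw [Finset.sum_eq_single a]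
    · simp
    · intro a' _ h; simp [Pi.single_eq_of_ne h]
    · simp
  have hg : ∀ i, ∑ a, ((z.1 i a + b i a) / softLen b i z) ^ 2 ≤ 1 := by
    intro i
    have hpos : 0 < softLen b i z := zero_lt_one.trans_le (one_le_softLen b i z)
    simp_rw [div_pow]
    rw [← Finset.sum_div, div_le_one (by positivity), softLen_sq]
    linarith
  have key := gordon_algebra (fun i => softWeight_nonneg b t i z) hg hw
  have hdiag : ∑ a, ∑ j, ∑ i, softWeight b t i z * (w i j ^ 2 / softLen b i z -
        ((z.1 i a + b i a) * w i j) ^ 2 / softLen b i z ^ 3 -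
        ((z.1 i a + b i a) * w i j / softLen b i z) ^ 2) =
      ∑ a, ∑ i, softWeight b t i z * (R ^ 2 / softLen b i z -
        ((z.1 i a + b i a) * R) ^ 2 / softLen b i z ^ 3 -
        ((z.1 i a + b i a) * R / softLen b i z) ^ 2) := by
    refine Finset.sum_congr rfl fun a _ => ?_
    rw [Finset.sum_comm]
    refine Finset.sum_congr rfl fun i _ => ?_
    have : ∀ r : ℝ, softWeight b t i z * (r ^ 2 / softLen b i z -
        ((z.1 i a + b i a) * r) ^ 2 / softLen b i z ^ 3 -
        ((z.1 i a + b i a) * r / softLen b i z) ^ 2) =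
        (softWeight b t i z * (1 / softLen b i z - (z.1 i a + b i a) ^ 2 / softLen b i z ^ 3 -
        ((z.1 i a + b i a) / softLen b i z) ^ 2)) * r ^ 2 := fun r => by ring
    simp_rw [this]
    rw [← Finset.mul_sum, hw]
  have hdiag2 : ∑ j, ∑ i, softWeight b t i z * (-(w i j) ^ 2) =
      ∑ i, softWeight b t i z * (-R ^ 2) := by
    rw [Finset.sum_comm]
    refine Finset.sum_congr rfl fun i _ => ?_
    rw [← Finset.mul_sum, Finset.sum_neg_distrib, hw]
  rw [Fintype.sum_sum_type, Fintype.sum_sum_type, Fintype.sum_prod_type]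
  simp only [primalDir, dualDir, softHess, softSlope, Sum.elim_inl, Sum.elim_inr, hsingle,
    hsingle2, Pi.zero_apply, add_zero, Finset.univ_unique, Finset.sum_singleton, mul_zero,
    Finset.sum_const_zero, zero_div, zero_add, sub_self, zero_sub, ne_eq, OfNat.ofNat_ne_zero,
    not_false_eq_true, zero_pow]
  simp_rw [← Finset.mul_sum]
  rw [← mul_add, ← mul_add]
  refine mul_le_mul_of_nonneg_left ?_ (softInd_nonneg b t z)
  simp_rw [Finset.sum_add_distrib]
  rw [hdiag, hdiag2]
  simp_rw [div_mul_eq_mul_div] at key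
  linarith

/-- Gordon's comparison in smoothed form. For vectors `w i` of the same norm `R`, the processes
`(A (w i), R γ)` and `(R g, ⟪h, w i⟫)` have the same covariances for equal indices; the covariances
for distinct indices differ in the direction that raises the probability of
`∀ i, t ≤ ‖A (w i) + b i‖ + R γ`. -/
theorem gordon_softInd {R : ℝ} {w : ι → Fin k → ℝ} (hw : ∀ i, ∑ j, w i j ^ 2 = R ^ 2) :
    ∫ p, softInd b t (fun _ a => R * p.1 a, fun i => ∑ j, w i j * p.2 j)
        ∂((gaussVector m).prod (gaussVector k)) ≤
      ∫ p, softInd b t (fun i a => ∑ j, p.1 a j * w i j, fun _ => R * p.2)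
        ∂((gaussMatrix m k).prod (gaussianReal 0 1)) := by
  have hc : Continuous (softInd b t) := (contDiff_softInd b t).continuous
  have h := gaussian_interpolation (f := softInd b t) (f' := fderiv ℝ (softInd b t))
    (H := softHess b t) (C₀ := 1) (C₁ := m + 1)
    (fun z => ((contDiff_softInd b t).differentiable (by norm_num) z).hasFDerivAt)
    ((contDiff_softInd b t).continuous_fderiv (by norm_num))
    (fun z => by rw [abs_of_nonneg (softInd_nonneg b t z)]; exact softInd_le_one b t z)
    (norm_fderiv_softInd_le b t) (hasDerivAt_fderiv_softInd b t) (continuous_softHess b t)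
    (fun v => ⟨_, fun z => abs_softHess_le b t z v⟩) (primalDir R w) (dualDir R w)
    (sum_softHess_le b t hw)
  have hsum := measurePreserving_sumPiEquivProdPi
    (fun _ : ((Fin m × Fin k) ⊕ Unit) ⊕ (Fin m ⊕ Fin k) => gaussianReal 0 1)
  have hP : MeasurePreserving
      (fun (ω : ((Fin m × Fin k) ⊕ Unit) ⊕ (Fin m ⊕ Fin k) → ℝ) =>
        ((fun a j => ω (Sum.inl (Sum.inl (a, j))), ω (Sum.inl (Sum.inr ()))) :
          (Fin m → Fin k → ℝ) × ℝ))
      (Measure.pi fun _ => gaussianReal 0 1) ((gaussMatrix m k).prod (gaussianReal 0 1)) := by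
    have h1 := measurePreserving_sumPiEquivProdPi
      (fun _ : (Fin m × Fin k) ⊕ Unit => gaussianReal 0 1)
    have h2 := (measurePreserving_curry_gaussMatrix m k).prod
      (measurePreserving_funUnique (gaussianReal 0 1) Unit)
    exact (h2.comp (h1.comp (measurePreserving_fst.comp hsum)))
  have hQ : MeasurePreserving
      (fun (ω : ((Fin m × Fin k) ⊕ Unit) ⊕ (Fin m ⊕ Fin k) → ℝ) =>
        ((fun a => ω (Sum.inr (Sum.inl a)), fun j => ω (Sum.inr (Sum.inr j))) :
          (Fin m → ℝ) × (Fin k → ℝ)))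
      (Measure.pi fun _ => gaussianReal 0 1) ((gaussVector m).prod (gaussVector k)) := by
    have h1 := measurePreserving_sumPiEquivProdPi (fun _ : Fin m ⊕ Fin k => gaussianReal 0 1)
    exact h1.comp (measurePreserving_snd.comp hsum)
  have c1 : Continuous fun p : (Fin m → Fin k → ℝ) × ℝ =>
      softInd b t (fun i a => ∑ j, p.1 a j * w i j, fun _ => R * p.2) := by fun_prop
  have c2 : Continuous fun p : (Fin m → ℝ) × (Fin k → ℝ) =>
      softInd b t (fun _ a => R * p.1 a, fun i => ∑ j, w i j * p.2 j) := by fun_prop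
  rw [← integral_comp_of_measurePreserving hP c1.aestronglyMeasurable,
    ← integral_comp_of_measurePreserving hQ c2.aestronglyMeasurable]
  convert h using 3 with ω ω
  · congr 1
    ext1
    · funext i a
      simp [Fintype.sum_sum_type, dualDir, Prod.fst_sum, Finset.sum_apply, Pi.single_apply,
        mul_comm]
    · funext i
      simp [Fintype.sum_sum_type, dualDir, Prod.snd_sum, Finset.sum_apply, mul_comm]
  · congr 1
    ext1
    · funext i a
      simp [Fintype.sum_sum_type, primalDir, Prod.fst_sum, Finset.sum_apply, Pi.single_apply,
        Fintype.sum_prod_type]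
    · funext i
      simp [Fintype.sum_sum_type, primalDir, Prod.snd_sum, mul_comm]

end SoftMin

/-! ### Gordon's comparison for probabilities -/

instance (m n : ℕ) : IsProbabilityMeasure (gaussMatrix m n) := by
  unfold gaussMatrix; infer_instance

instance (d : ℕ) : IsProbabilityMeasure (gaussVector d) := by
  unfold gaussVector; infer_instance

instance (m k : ℕ) : IsProbabilityMeasure (gaussTriple m k) := by
  unfold gaussTriple; infer_instance

/-- The Euclidean norm of a plain vector `Fin d → ℝ`, whose own norm is the sup norm. -/
noncomputable def euclNorm {d : ℕ} (v : Fin d → ℝ) : ℝ := √(∑ a, v a ^ 2)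

theorem euclNorm_eq_norm {d : ℕ} (v : Fin d → ℝ) : euclNorm v = ‖WithLp.toLp 2 v‖ := by
  simp [euclNorm, EuclideanSpace.norm_eq]

theorem euclNorm_ofLp {d : ℕ} (v : EuclideanSpace ℝ (Fin d)) : euclNorm v.ofLp = ‖v‖ := by
  simp [euclNorm_eq_norm]

theorem euclNorm_nonneg {d : ℕ} (v : Fin d → ℝ) : 0 ≤ euclNorm v := Real.sqrt_nonneg _

theorem sq_euclNorm {d : ℕ} (v : Fin d → ℝ) : euclNorm v ^ 2 = ∑ a, v a ^ 2 :=
  Real.sq_sqrt (Finset.sum_nonneg fun _ _ => sq_nonneg _)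

@[fun_prop]
theorem continuous_euclNorm {d : ℕ} : Continuous (euclNorm : (Fin d → ℝ) → ℝ) := by
  unfold euclNorm; fun_prop

theorem euclNorm_le_of_abs_le {d : ℕ} {u v : Fin d → ℝ} (h : ∀ a, |u a| ≤ |v a|) :
    euclNorm u ≤ euclNorm v :=
  Real.sqrt_le_sqrt (Finset.sum_le_sum fun a _ => sq_le_sq.2 (h a))

theorem euclNorm_add_le {d : ℕ} (u v : Fin d → ℝ) : euclNorm (u + v) ≤ euclNorm u + euclNorm v := by
  simp only [euclNorm_eq_norm, WithLp.toLp_add]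
  exact norm_add_le _ _

theorem euclNorm_smul {d : ℕ} (c : ℝ) (v : Fin d → ℝ) : euclNorm (c • v) = |c| * euclNorm v := by
  simp only [euclNorm_eq_norm, WithLp.toLp_smul, norm_smul, Real.norm_eq_abs]

theorem abs_dot_le {d : ℕ} (u v : Fin d → ℝ) : |∑ a, u a * v a| ≤ euclNorm u * euclNorm v := by
  have := abs_real_inner_le_norm (WithLp.toLp 2 v) (WithLp.toLp 2 u)
  rw [euclNorm_eq_norm, euclNorm_eq_norm, mul_comm]
  simpa [PiLp.inner_apply] using this

/-- Gordon's comparison of two minima over a finite index type. The margin `t₁ < t₂` absorbs the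
error of the smooth surrogate `softInd`. -/
theorem gordon_prob_fintype {ι : Type*} [Fintype ι] {m k : ℕ} {R : ℝ} {w : ι → Fin k → ℝ}
    (hw : ∀ i, ∑ j, w i j ^ 2 = R ^ 2) (b : ι → Fin m → ℝ) {t₁ t₂ : ℝ} (ht : t₁ < t₂) :
    ((gaussMatrix m k).prod (gaussianReal 0 1))
        {p | ∃ i, euclNorm (fun a => ∑ j, p.1 a j * w i j + b i a) + R * p.2 < t₁} ≤
      ((gaussVector m).prod (gaussVector k))
        {p | ∃ i, euclNorm (fun a => R * p.1 a + b i a) + ∑ j, w i j * p.2 j < t₂} := by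
  set μ := (gaussMatrix m k).prod (gaussianReal 0 1)
  set ν := (gaussVector m).prod (gaussVector k)
  set S := {p : (Fin m → Fin k → ℝ) × ℝ |
    ∃ i, euclNorm (fun a => ∑ j, p.1 a j * w i j + b i a) + R * p.2 < t₁}
  set U := {p : (Fin m → ℝ) × (Fin k → ℝ) |
    ∃ i, euclNorm (fun a => R * p.1 a + b i a) + ∑ j, w i j * p.2 j < t₂}
  have hS : MeasurableSet S := by
    have : IsOpen S := by
      simp only [S, Set.ofPred_exists]
      exact isOpen_iUnion fun i => isOpen_lt (by fun_prop) continuous_const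
    exact this.measurableSet
  have hU : MeasurableSet U := by
    have : IsOpen U := by
      simp only [U, Set.ofPred_exists]
      exact isOpen_iUnion fun i => isOpen_lt (by fun_prop) continuous_const
    exact this.measurableSet
  set t := (t₁ + t₂) / 2 with ht_def
  have h1t : 0 < t - t₁ := by rw [ht_def]; linarith
  have h2t : 0 < t₂ - t := by rw [ht_def]; linarith
  let ε₁ : ℝ → ℝ := fun β => Real.exp (-Real.exp (β * (t - t₁) - 1))
  let ε₂ : ℝ → ℝ := fun β => 1 - Real.exp (-(Fintype.card ι * Real.exp (-(β * (t₂ - t)))))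
  -- Rescaling by a large `β` makes the smooth surrogate as sharp as the indicator.
  have main : ∀ β : ℝ, 0 < β → μ.real S ≤ ν.real U + (ε₁ β + ε₂ β) := by
    intro β hβ
    have hscale : ∀ (i : ι) (V : Fin m → ℝ) (s : ℝ) (z : (ι → Fin m → ℝ) × (ι → ℝ)),
        z.1 i = β • V → z.2 i = β * s →
        β * (euclNorm (fun a => V a + b i a) + s) ≤ softLen (fun i => β • b i) i z + z.2 i ∧
        softLen (fun i => β • b i) i z + z.2 i ≤
          β * (euclNorm (fun a => V a + b i a) + s) + 1 := by
      intro i V s z h1 h2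
      have hsum : ∑ a, (z.1 i a + (β • b i) a) ^ 2 =
          (β * euclNorm (fun a => V a + b i a)) ^ 2 := by
        rw [mul_pow, sq_euclNorm, Finset.mul_sum, h1]
        exact Finset.sum_congr rfl fun a _ => by
          simp only [Pi.smul_apply, smul_eq_mul]; ring
      have hn : 0 ≤ β * euclNorm (fun a => V a + b i a) :=
        mul_nonneg hβ.le (euclNorm_nonneg _)
      rw [softLen, hsum, h2]
      constructor
      · have := Real.le_sqrt_of_sq_le (x := β * euclNorm (fun a => V a + b i a))
          (y := 1 + (β * euclNorm (fun a => V a + b i a)) ^ 2) (by linarith)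
        linarith
      · have := Real.sqrt_le_iff.2 (⟨by linarith, by nlinarith⟩ :
          0 ≤ β * euclNorm (fun a => V a + b i a) + 1 ∧
          1 + (β * euclNorm (fun a => V a + b i a)) ^ 2 ≤
            (β * euclNorm (fun a => V a + b i a) + 1) ^ 2)
        linarith
    have hw' : ∀ i, ∑ j, (β • w i) j ^ 2 = (β * R) ^ 2 := fun i => by
      simp only [Pi.smul_apply, smul_eq_mul, mul_pow]
      rw [← Finset.mul_sum, hw]
    have key := gordon_softInd (m := m) (fun i => β • b i) (β * t) hw'
    set Φ := softInd (fun i => β • b i) (β * t) with hΦ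
    have hΦc : Continuous Φ := (contDiff_softInd _ _).continuous
    have hΦ0 : ∀ z, 0 ≤ Φ z := softInd_nonneg _ _
    have hΦ1 : ∀ z, Φ z ≤ 1 := softInd_le_one _ _
    have hX : ∫ p, Φ (fun i a => ∑ j, p.1 a j * (β • w i) j, fun _ => β * R * p.2) ∂μ ≤
        1 - μ.real S + ε₁ β := by
      have hpt : ∀ p, Φ (fun i a => ∑ j, p.1 a j * (β • w i) j, fun _ => β * R * p.2) ≤
          1 - S.indicator 1 p + ε₁ β := by
        intro p
        by_cases hp : p ∈ S
        · rw [Set.indicator_of_mem hp]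
          obtain ⟨i, hi⟩ := hp
          have h2 := (hscale i (fun a => ∑ j, p.1 a j * w i j) (R * p.2)
            (fun i a => ∑ j, p.1 a j * (β • w i) j, fun _ => β * R * p.2) (by
              funext a
              simp only [Pi.smul_apply, smul_eq_mul, Finset.mul_sum]
              exact Finset.sum_congr rfl fun j _ => by ring) (by simp only; ring)).2
          simp only [Pi.one_apply, sub_self, zero_add]
          refine Real.exp_le_exp.2 (neg_le_neg ?_)
          refine le_trans ?_ (Finset.single_le_sum
            (fun i _ => softWeight_nonneg (fun i => β • b i) (β * t) i _) (Finset.mem_univ i))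
          refine Real.exp_le_exp.2 ?_
          nlinarith
        · rw [Set.indicator_of_notMem hp]
          linarith [hΦ1 (fun i a => ∑ j, p.1 a j * (β • w i) j, fun _ => β * R * p.2),
            (Real.exp_pos (-Real.exp (β * (t - t₁) - 1))).le]
      have hint : Integrable (S.indicator (1 : (Fin m → Fin k → ℝ) × ℝ → ℝ)) μ :=
        (integrable_const (1 : ℝ)).indicator hS
      have := integral_mono (μ := μ) (Integrable.of_bound (C := 1)
        (Continuous.aestronglyMeasurable (by fun_prop)) (ae_of_all _ fun p => by
          rw [Real.norm_eq_abs, abs_of_nonneg (hΦ0 _)]; exact hΦ1 _))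
        (((integrable_const 1).sub hint).add (integrable_const (ε₁ β))) hpt
      refine this.trans (le_of_eq ?_)
      have e := integral_add ((integrable_const (μ := μ) (1 : ℝ)).sub hint)
        (integrable_const (ε₁ β))
      refine e.trans ?_
      have e' := integral_sub (integrable_const (μ := μ) (1 : ℝ)) hint
      rw [integral_indicator_one hS] at e'
      simpa using! e'
    have hY : 1 - ν.real U - ε₂ β ≤
        ∫ p, Φ (fun _ a => β * R * p.1 a, fun i => ∑ j, (β • w i) j * p.2 j) ∂ν := by
      have hpt : ∀ p, 1 - U.indicator 1 p - ε₂ β ≤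
          Φ (fun _ a => β * R * p.1 a, fun i => ∑ j, (β • w i) j * p.2 j) := by
        intro p
        have hε : 0 ≤ ε₂ β := by
          simp only [ε₂, sub_nonneg, Real.exp_le_one_iff]
          exact neg_nonpos.2 (by positivity)
        by_cases hp : p ∈ U
        · rw [Set.indicator_of_mem hp]
          have := hΦ0 (fun _ a => β * R * p.1 a, fun i => ∑ j, (β • w i) j * p.2 j)
          simp only [Pi.one_apply]
          linarith
        · rw [Set.indicator_of_notMem hp]
          simp only [U, Set.mem_ofPred_eq, not_exists, not_lt] at hp
          simp only [ε₂, sub_zero, sub_sub_cancel]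
          refine Real.exp_le_exp.2 (neg_le_neg ?_)
          have : ∀ i ∈ Finset.univ, softWeight (fun i => β • b i) (β * t) i
              (fun _ a => β * R * p.1 a, fun i => ∑ j, (β • w i) j * p.2 j) ≤
              Real.exp (-(β * (t₂ - t))) := by
            intro i _
            have h1 := (hscale i (fun a => R * p.1 a) (∑ j, w i j * p.2 j)
              (fun _ a => β * R * p.1 a, fun i => ∑ j, (β • w i) j * p.2 j) (by
                funext a
                simp only [Pi.smul_apply, smul_eq_mul]; ring) (by
                simp only [Pi.smul_apply, smul_eq_mul, Finset.mul_sum]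
                exact Finset.sum_congr rfl fun j _ => by ring)).1
            refine Real.exp_le_exp.2 ?_
            have := hp i
            nlinarith
          refine (Finset.sum_le_sum this).trans ?_
          simp
      have hint : Integrable (U.indicator (1 : (Fin m → ℝ) × (Fin k → ℝ) → ℝ)) ν :=
        (integrable_const (1 : ℝ)).indicator hU
      have := integral_mono (μ := ν)
        (((integrable_const 1).sub hint).sub (integrable_const (ε₂ β)))
        (Integrable.of_bound (C := 1)
        (Continuous.aestronglyMeasurable (by fun_prop)) (ae_of_all _ fun p => by
          rw [Real.norm_eq_abs, abs_of_nonneg (hΦ0 _)]; exact hΦ1 _)) hpt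
      refine le_trans (le_of_eq ?_) this
      have e := integral_sub ((integrable_const (μ := ν) (1 : ℝ)).sub hint)
        (integrable_const (ε₂ β))
      refine Eq.trans ?_ e.symm
      have e' := integral_sub (integrable_const (μ := ν) (1 : ℝ)) hint
      rw [integral_indicator_one hU] at e'
      simpa using! e'.symm
    linarith
  have hε₁ : Tendsto ε₁ atTop (𝓝 0) := by
    refine Real.tendsto_exp_atBot.comp (tendsto_neg_atTop_atBot.comp
      (Real.tendsto_exp_atTop.comp (tendsto_atTop_add_const_right _ (-1) ?_)))
    exact tendsto_id.atTop_mul_const h1t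
  have hε₂ : Tendsto ε₂ atTop (𝓝 0) := by
    have h : Tendsto (fun β : ℝ => Real.exp (-(β * (t₂ - t)))) atTop (𝓝 0) :=
      Real.tendsto_exp_atBot.comp (tendsto_neg_atTop_atBot.comp
        (tendsto_id.atTop_mul_const h2t))
    have h' := (((h.const_mul (Fintype.card ι : ℝ)).neg).rexp).const_sub 1
    simpa using h'
  have hlim : Tendsto (fun β => ν.real U + (ε₁ β + ε₂ β)) atTop (𝓝 (ν.real U)) := by
    simpa using (hε₁.add hε₂).const_add (ν.real U)
  have := ge_of_tendsto hlim ((eventually_gt_atTop 0).mono main)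
  exact (ENNReal.toReal_le_toReal (measure_ne_top _ _) (measure_ne_top _ _)).1 this

/-- Gordon's comparison over a countable index type, by monotone limits over finite subsets. -/
theorem gordon_prob {ι : Type*} [Countable ι] {m k : ℕ} {R : ℝ} {w : ι → Fin k → ℝ}
    (hw : ∀ i, ∑ j, w i j ^ 2 = R ^ 2) (b : ι → Fin m → ℝ) {t₁ t₂ : ℝ} (ht : t₁ < t₂) :
    ((gaussMatrix m k).prod (gaussianReal 0 1))
        {p | ∃ i, euclNorm (fun a => ∑ j, p.1 a j * w i j + b i a) + R * p.2 < t₁} ≤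
      ((gaussVector m).prod (gaussVector k))
        {p | ∃ i, euclNorm (fun a => R * p.1 a + b i a) + ∑ j, w i j * p.2 j < t₂} := by
  let S : Finset ι → Set ((Fin m → Fin k → ℝ) × ℝ) := fun s =>
    {p | ∃ i : s, euclNorm (fun a => ∑ j, p.1 a j * w i j + b i a) + R * p.2 < t₁}
  have hunion : {p : (Fin m → Fin k → ℝ) × ℝ |
      ∃ i, euclNorm (fun a => ∑ j, p.1 a j * w i j + b i a) + R * p.2 < t₁} = ⋃ s, S s := by
    ext p
    simp only [S, Set.mem_ofPred_eq, Set.mem_iUnion]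
    constructor
    · rintro ⟨i, hi⟩
      exact ⟨{i}, ⟨i, by simp⟩, hi⟩
    · rintro ⟨s, i, hi⟩
      exact ⟨i, hi⟩
  have hmono : Monotone S := by
    rintro s s' hs p ⟨i, hi⟩
    exact ⟨⟨i, hs i.2⟩, hi⟩
  rw [hunion, hmono.directed_le.measure_iUnion]
  refine iSup_le fun s => ?_
  refine (gordon_prob_fintype (ι := s) (w := fun i => w i) (fun i => hw i) (fun i => b i) ht).trans
    (measure_mono ?_)
  rintro p ⟨i, hi⟩
  exact ⟨i, hi⟩

/-- `‖|g⁽⁰⁾| - |x g⁽⁰⁾ + r g|‖ - r ‖h‖`, whose positive part, squared and divided by `n`, is the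
random dual. -/
noncomputable def gap {m k : ℕ} (x r : ℝ) (g₀ g : Fin m → ℝ) (h : Fin k → ℝ) : ℝ :=
  euclNorm (fun i => |g₀ i| - |x * g₀ i + r * g i|) - r * euclNorm h

/-- `‖|A e₁| - |A u|‖` for `u = (x, w)`, with `g₀` the first column of `A` and `B` the others. -/
noncomputable def mismatch {m k : ℕ} (x : ℝ) (g₀ : Fin m → ℝ) (B : Fin m → Fin k → ℝ)
    (w : Fin k → ℝ) : ℝ :=
  euclNorm (fun i => |g₀ i| - |x * g₀ i + ∑ j, B i j * w j|)

theorem continuous_gap {m k : ℕ} (x r : ℝ) :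
    Continuous fun p : (Fin m → ℝ) × (Fin m → ℝ) × (Fin k → ℝ) => gap x r p.1 p.2.1 p.2.2 := by
  unfold gap; fun_prop

theorem isOpen_mismatch_lt {m k : ℕ} (x r t : ℝ) :
    IsOpen {p : (Fin m → ℝ) × (Fin m → Fin k → ℝ) |
      ∃ w, ∑ j, w j ^ 2 = r ^ 2 ∧ mismatch x p.1 p.2 w < t} := by
  have : {p : (Fin m → ℝ) × (Fin m → Fin k → ℝ) |
      ∃ w, ∑ j, w j ^ 2 = r ^ 2 ∧ mismatch x p.1 p.2 w < t} =
      ⋃ w ∈ {w : Fin k → ℝ | ∑ j, w j ^ 2 = r ^ 2}, {p | mismatch x p.1 p.2 w < t} := by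
    ext p; simp
  rw [this]
  refine isOpen_biUnion fun w _ => isOpen_lt ?_ continuous_const
  unfold mismatch
  fun_prop

/-- Absolute values are eliminated by a minimum over sign patterns `s`, so that Gordon's comparison
applies to the offsets `x g₀ - s g₀`; a countable dense subset of the sphere suffices. -/
theorem gordon_mismatch_add {m k : ℕ} {x r : ℝ} (hr : 0 ≤ r) (g₀ : Fin m → ℝ) {t₁ t₂ : ℝ}
    (ht : t₁ < t₂) :
    ((gaussMatrix m k).prod (gaussianReal 0 1))
        {p | ∃ w, ∑ j, w j ^ 2 = r ^ 2 ∧ mismatch x g₀ p.1 w + r * p.2 < t₁} ≤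
      ((gaussVector m).prod (gaussVector k)) {p | gap x r g₀ p.1 p.2 < t₂} := by
  obtain ⟨s, hs, hsd⟩ := TopologicalSpace.exists_countable_dense
    {w : Fin k → ℝ // ∑ j, w j ^ 2 = r ^ 2}
  have : Countable s := hs.to_subtype
  let b : s × (Fin m → Bool) → Fin m → ℝ := fun i a =>
    x * g₀ a - if i.2 a then g₀ a else -g₀ a
  have key := gordon_prob (ι := s × (Fin m → Bool)) (m := m) (R := r) (w := fun i => i.1.1.1)
    (fun i => i.1.1.2) b ht
  refine (measure_mono ?_).trans (key.trans (measure_mono ?_))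
  · -- The sign pattern records whether `g₀ a` and the `a`-th measurement of `u` agree in sign.
    rintro p ⟨w, hw, hp⟩
    have hopen : IsOpen {w : {w : Fin k → ℝ // ∑ j, w j ^ 2 = r ^ 2} |
        mismatch x g₀ p.1 w.1 + r * p.2 < t₁} := by
      have hc : Continuous fun w : Fin k → ℝ => mismatch x g₀ p.1 w + r * p.2 := by
        unfold mismatch; fun_prop
      exact isOpen_lt (hc.comp continuous_subtype_val) continuous_const
    obtain ⟨w', hw', hws⟩ := hsd.inter_open_nonempty _ hopen ⟨⟨w, hw⟩, hp⟩
    refine ⟨⟨⟨w', hws⟩, fun a => decide (0 ≤ g₀ a * (x * g₀ a + ∑ j, p.1 a j * w'.1 j))⟩, ?_⟩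
    refine lt_of_le_of_lt (add_le_add_left (euclNorm_le_of_abs_le fun a => ?_) _) hw'
    simp only [b, decide_eq_true_eq]
    set v := x * g₀ a + ∑ j, p.1 a j * w'.1 j
    have hv : ∑ j, p.1 a j * w'.1 j = v - x * g₀ a := by simp [v]
    rw [hv]
    split_ifs with h
    · rcases mul_nonneg_iff.1 h with ⟨h1, h2⟩ | ⟨h1, h2⟩
      · rw [abs_of_nonneg h1, abs_of_nonneg h2, abs_sub_comm]; exact le_of_eq (by congr 1; ring)
      · rw [abs_of_nonpos h1, abs_of_nonpos h2]; exact le_of_eq (by congr 1; ring)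
    · rcases mul_neg_iff.1 (not_le.1 h) with ⟨h1, h2⟩ | ⟨h1, h2⟩
      · rw [abs_of_pos h1, abs_of_neg h2]; exact le_of_eq (by congr 1; ring)
      · rw [abs_of_neg h1, abs_of_pos h2, abs_sub_comm]; exact le_of_eq (by congr 1; ring)
  · rintro p ⟨i, hi⟩
    refine lt_of_le_of_lt (sub_le_iff_le_add.2 ?_) hi
    have h1 := neg_le_of_abs_le (abs_dot_le i.1.1.1 p.2)
    have h2 : euclNorm i.1.1.1 = r := by
      rw [euclNorm, i.1.1.2, Real.sqrt_sq hr]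
    rw [h2] at h1
    have h3 : euclNorm (fun a => |g₀ a| - |x * g₀ a + r * p.1 a|) ≤
        euclNorm (fun a => r * p.1 a + b i a) := by
      refine euclNorm_le_of_abs_le fun a => ?_
      have : ∀ y : ℝ, |y| = |g₀ a| → |(|g₀ a| - |x * g₀ a + r * p.1 a|)| ≤
          |r * p.1 a + (x * g₀ a - y)| := fun y hy => by
        rw [← hy, abs_sub_comm]
        refine (abs_abs_sub_abs_le_abs_sub _ _).trans (le_of_eq ?_)
        congr 1; ring
      refine this _ ?_
      split_ifs <;> simp
    linarith

theorem measurePreserving_cols (m k : ℕ) :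
    MeasurePreserving (fun A : Fin m → Fin (k + 1) → ℝ =>
      ((fun i => A i 0, fun i j => A i j.succ) : (Fin m → ℝ) × (Fin m → Fin k → ℝ)))
      (gaussMatrix m (k + 1)) ((gaussVector m).prod (gaussMatrix m k)) := by
  have h1 : MeasurePreserving
      (fun (A : Fin m → Fin (k + 1) → ℝ) i => MeasurableEquiv.piFinSuccAbove (fun _ => ℝ) 0 (A i))
      (gaussMatrix m (k + 1)) (Measure.pi fun _ : Fin m =>
        (gaussianReal 0 1).prod (Measure.pi fun _ : Fin k => gaussianReal 0 1)) :=
    measurePreserving_pi _ _ fun _ =>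
      measurePreserving_piFinSuccAbove (fun _ : Fin (k + 1) => gaussianReal 0 1) 0
  exact (measurePreserving_arrowProdEquivProdArrow ℝ (Fin k → ℝ) (Fin m) _ _).comp h1

theorem measurePreserving_col (m k : ℕ) :
    MeasurePreserving (fun A : Fin m → Fin (k + 1) → ℝ => fun i => A i 0)
      (gaussMatrix m (k + 1)) (gaussVector m) :=
  measurePreserving_fst.comp (measurePreserving_cols m k)

/-- The probability form of Gordon's comparison for the random primal. The auxiliary Gaussian `γ` is
removed at the price of the constant factor `ℙ(γ < 0)`, because `mismatch < t₁` and `γ < 0` imply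
`mismatch + r γ < t₁`. -/
theorem gordon_mismatch {m k : ℕ} {x r : ℝ} (hr : 0 ≤ r) {t₁ t₂ : ℝ} (ht : t₁ < t₂) :
    gaussMatrix m (k + 1) {A | ∃ w, ∑ j, w j ^ 2 = r ^ 2 ∧
        mismatch x (fun i => A i 0) (fun i j => A i j.succ) w < t₁} * gaussianReal 0 1 (Set.Iio 0) ≤
      gaussTriple m k {G | gap x r (fun i => G.1 i 0) G.2.1 G.2.2 < t₂} := by
  have hS := (isOpen_mismatch_lt (m := m) (k := k) x r t₁).measurableSet
  have hU : MeasurableSet {p : (Fin m → ℝ) × (Fin m → ℝ) × (Fin k → ℝ) |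
      gap x r p.1 p.2.1 p.2.2 < t₂} :=
    (isOpen_lt (continuous_gap x r) continuous_const).measurableSet
  have e1 := (measurePreserving_cols m k).measure_preimage hS.nullMeasurableSet
  have e2 := ((measurePreserving_col m k).prod (MeasurePreserving.id
    ((gaussVector m).prod (gaussVector k)))).measure_preimage hU.nullMeasurableSet
  have e1' := Measure.prod_apply (μ := gaussVector m) (ν := gaussMatrix m k) hS
  have e2' := Measure.prod_apply (μ := gaussVector m)
    (ν := (gaussVector m).prod (gaussVector k)) hU
  refine le_trans (le_of_eq (congrArg (· * gaussianReal 0 1 (Set.Iio 0)) (e1.trans e1'))) ?_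
  refine le_trans ?_ (le_of_eq (e2.trans e2').symm)
  rw [← lintegral_mul_const _ (measurable_measure_prodMk_left hS)]
  refine lintegral_mono fun g₀ => ?_
  refine le_trans ?_ (gordon_mismatch_add (k := k) (x := x) hr g₀ ht)
  rw [← Measure.prod_prod]
  refine measure_mono ?_
  rintro ⟨B, γ⟩ ⟨⟨w, hw, hlt⟩, hγ⟩
  refine ⟨w, hw, ?_⟩
  have : r * γ ≤ 0 := mul_nonpos_of_nonneg_of_nonpos hr (le_of_lt hγ)
  have hlt' : mismatch x g₀ B w < t₁ := hlt
  change mismatch x g₀ B w + r * γ < t₁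
  linarith

/-! ### Evaluation of the random primal and of the random dual -/

theorem meas_single {M k : ℕ} (A : Fin M → Fin (k + 1) → ℝ) (i : Fin M) :
    meas A (EuclideanSpace.single 0 1) i = A i 0 := by
  simp [meas, PiLp.single_apply]

theorem meas_succ {M k : ℕ} (A : Fin M → Fin (k + 1) → ℝ) (u : EuclideanSpace ℝ (Fin (k + 1)))
    (i : Fin M) : meas A u i = u 0 * A i 0 + ∑ j : Fin k, A i j.succ * u j.succ := by
  rw [meas, Fin.sum_univ_succ, mul_comm]

theorem primalFun_eq {M k : ℕ} (x : ℝ) (A : Fin M → Fin (k + 1) → ℝ)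
    (w : EuclideanSpace ℝ (Fin k)) (z y : EuclideanSpace ℝ (Fin M)) :
    primalFun x A w z y = ∑ i, (|A i 0| - |z i|) ^ 2 +
      ∑ i, y i * (x * A i 0 + ∑ j : Fin k, A i j.succ * w j - z i) := by
  simp only [primalFun, mul_sub, mul_add, Finset.sum_sub_distrib, Finset.sum_add_distrib]
  rw [Finset.sum_mul]
  simp only [mul_comm x, mul_assoc]
  ring

theorem dualFun_eq {M k : ℕ} (x : ℝ)
    (G : (Fin M → Fin (k + 1) → ℝ) × (Fin M → ℝ) × (Fin k → ℝ))
    (w : EuclideanSpace ℝ (Fin k)) (z y : EuclideanSpace ℝ (Fin M)) :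
    dualFun x G w z y = ∑ i, (|G.1 i 0| - |z i|) ^ 2 +
      ∑ i, y i * (x * G.1 i 0 + ‖w‖ * G.2.1 i - z i) + (∑ j, w j * G.2.2 j) * ‖y‖ := by
  simp only [dualFun, mul_sub, mul_add, Finset.sum_sub_distrib, Finset.sum_add_distrib]
  rw [Finset.sum_mul, Finset.sum_mul]
  have h1 : ∀ i, y i * (x * G.1 i 0) = y i * G.1 i 0 * x := fun i => by ring
  have h2 : ∀ i, y i * (‖w‖ * G.2.1 i) = y i * G.2.1 i * ‖w‖ := fun i => by ring
  simp only [h1, h2]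
  ring

theorem inner_single_zero {k : ℕ} (u : EuclideanSpace ℝ (Fin (k + 1))) :
    inner ℝ u (EuclideanSpace.single 0 1) = u 0 := by
  simp [EuclideanSpace.inner_single_right]

theorem norm_sq_succ {k : ℕ} (u : EuclideanSpace ℝ (Fin (k + 1))) :
    ‖u‖ ^ 2 = u 0 ^ 2 + ∑ j : Fin k, u j.succ ^ 2 := by
  rw [EuclideanSpace.real_norm_sq_eq, Fin.sum_univ_succ]

/-- The maximum over `y` is `⊤` unless `z = A u` for `u = (x, w)`, so it acts as the constraint. -/
theorem frp_eq_fpro {c x : ℝ} (hxc : x ^ 2 ≤ c) {M k : ℕ} (A : Fin M → Fin (k + 1) → ℝ) :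
    frp c x A = fpro c x A (EuclideanSpace.single 0 1) / (((k + 1 : ℕ) : ℝ) : EReal) := by
  rw [frp]
  congr 1
  refine le_antisymm ?_ ?_
  · refine le_iInf₂ fun p hp => ?_
    obtain ⟨hz, hx, hc⟩ := hp
    rw [inner_single_zero] at hx
    let w : EuclideanSpace ℝ (Fin k) := WithLp.toLp 2 fun j => p.1 j.succ
    have hw : ‖w‖ = √(c - x ^ 2) := by
      rw [EuclideanSpace.norm_eq]
      congr 1
      rw [norm_sq_succ, hx] at hc
      simp only [w, Real.norm_eq_abs, sq_abs]
      linarith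
    refine (iInf₂_le w hw).trans ((iInf_le _ p.2).trans (iSup_le fun y => ?_))
    rw [EReal.coe_le_coe_iff, primalFun_eq]
    have : ∀ i, x * A i 0 + ∑ j : Fin k, A i j.succ * w j - p.2 i = 0 := fun i => by
      rw [← hz i, meas_succ, hx]; simp [w]
    simp [this, meas_single]
  · refine le_iInf₂ fun w hw => le_iInf fun z => ?_
    by_cases h : ∀ i, x * A i 0 + ∑ j : Fin k, A i j.succ * w j - z i = 0
    · refine le_trans ?_ (le_iSup _ (0 : EuclideanSpace ℝ (Fin M)))
      let u : EuclideanSpace ℝ (Fin (k + 1)) := WithLp.toLp 2 (Fin.cons x fun j => w j)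
      have hu : (u, z) ∈ {p : EuclideanSpace ℝ (Fin (k + 1)) × EuclideanSpace ℝ (Fin M) |
          (∀ i, meas A p.1 i = p.2 i) ∧ inner ℝ p.1 (EuclideanSpace.single 0 1) = x ∧
            ‖p.1‖ ^ 2 = c} := by
        refine ⟨fun i => ?_, ?_, ?_⟩
        · rw [meas_succ]
          have := h i
          simp only [u, Fin.cons_zero, Fin.cons_succ]
          linarith
        · rw [inner_single_zero]; simp [u]
        · rw [norm_sq_succ]
          have hw2 : ‖w‖ ^ 2 = c - x ^ 2 := by
            rw [hw, Real.sq_sqrt (by linarith)]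
          rw [EuclideanSpace.real_norm_sq_eq] at hw2
          simp only [u, Fin.cons_zero, Fin.cons_succ]
          linarith
      refine (iInf₂_le _ hu).trans ?_
      rw [EReal.coe_le_coe_iff, primalFun_eq]
      simp [meas_single]
    · have htop : ⨆ y : EuclideanSpace ℝ (Fin M), (primalFun x A w z y : EReal) = ⊤ := by
        rw [EReal.eq_top_iff_forall_lt]
        intro K
        set d : Fin M → ℝ := fun i => x * A i 0 + ∑ j : Fin k, A i j.succ * w j - z i with hd
        have hdpos : 0 < ∑ i, d i ^ 2 := by
          push Not at h
          obtain ⟨i, hi⟩ := h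
          exact Finset.sum_pos' (fun _ _ => sq_nonneg _) ⟨i, Finset.mem_univ i, by positivity⟩
        refine lt_of_lt_of_le ?_ (le_iSup _ (WithLp.toLp 2 (((|K| + 1) / ∑ i, d i ^ 2) • d)))
        rw [EReal.coe_lt_coe_iff, primalFun_eq]
        have : ∑ i, ((|K| + 1) / ∑ i, d i ^ 2) * d i * d i = |K| + 1 := by
          simp_rw [mul_assoc, ← sq]
          rw [← Finset.mul_sum, div_mul_cancel₀ _ hdpos.ne']
        change K < _ + ∑ i, ((|K| + 1) / ∑ i, d i ^ 2) * d i * d i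
        rw [this]
        have h0 : 0 ≤ ∑ i, (|A i 0| - |z i|) ^ 2 := Finset.sum_nonneg fun _ _ => sq_nonneg _
        linarith [le_abs_self K]
      rw [htop]
      exact le_top

theorem le_fpro_single {c x : ℝ} (hxc : x ^ 2 ≤ c) {M k : ℕ} {A : Fin M → Fin (k + 1) → ℝ} {τ : ℝ}
    (hτ : 0 ≤ τ) (h : ∀ w : Fin k → ℝ, ∑ j, w j ^ 2 = √(c - x ^ 2) ^ 2 →
      τ ≤ mismatch x (fun i => A i 0) (fun i j => A i j.succ) w) :
    ((τ ^ 2 : ℝ) : EReal) ≤ fpro c x A (EuclideanSpace.single 0 1) := by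
  refine le_iInf₂ fun p hp => ?_
  obtain ⟨hz, hx, hc⟩ := hp
  rw [inner_single_zero] at hx
  rw [EReal.coe_le_coe_iff]
  have := h (fun j => p.1 j.succ) (by
    rw [Real.sq_sqrt (by linarith)]
    rw [norm_sq_succ, hx] at hc
    linarith)
  refine (pow_le_pow_left₀ hτ this 2).trans (le_of_eq ?_)
  rw [mismatch, sq_euclNorm]
  refine Finset.sum_congr rfl fun i _ => ?_
  rw [meas_single, ← hz i, meas_succ, hx]

theorem exists_norm_eq_dot_eq {k : ℕ} (hk : 0 < k) {r : ℝ} (hr : 0 ≤ r) (h : Fin k → ℝ) :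
    ∃ w : EuclideanSpace ℝ (Fin k), ‖w‖ = r ∧ ∑ j, w j * h j = -(r * euclNorm h) := by
  by_cases h0 : euclNorm h = 0
  · have hz : ∀ j, h j = 0 := by
      intro j
      rw [euclNorm_eq_norm, norm_eq_zero] at h0
      simpa using congrArg (fun v : EuclideanSpace ℝ (Fin k) => v j) h0
    refine ⟨EuclideanSpace.single ⟨0, hk⟩ r, by simp [abs_of_nonneg hr], ?_⟩
    simp [hz, h0]
  · refine ⟨WithLp.toLp 2 (-(r / euclNorm h) • h), ?_, ?_⟩
    · rw [← euclNorm_eq_norm, euclNorm_smul, abs_neg,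
        abs_of_nonneg (div_nonneg hr (euclNorm_nonneg _)), div_mul_cancel₀ _ h0]
    · simp only [Pi.smul_apply, smul_eq_mul, mul_assoc, ← sq]
      rw [← Finset.mul_sum, ← sq_euclNorm]
      field_simp

/-- Moving `|v|` towards `|a|` by at most `ρ`, with the signs of `v` kept, is the projection that
attains the distance of `|a|` from the ball of radius `ρ` around `v`, modulo signs. -/
theorem exists_abs_approx {M : ℕ} (a v : Fin M → ℝ) {ρ : ℝ} (hρ : 0 ≤ ρ) :
    ∃ z : Fin M → ℝ, euclNorm (v - z) ≤ ρ ∧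
      euclNorm (fun i => |a i| - |z i|) = max 0 (euclNorm (fun i => |a i| - |v i|) - ρ) := by
  set D := euclNorm (fun i => |a i| - |v i|) with hD
  have hD0 : 0 ≤ D := euclNorm_nonneg _
  obtain ⟨l, hl0, hl1, hlρ, hlD⟩ : ∃ l : ℝ, 0 ≤ l ∧ l ≤ 1 ∧ l * D ≤ ρ ∧
      (1 - l) * D = max 0 (D - ρ) := by
    rcases le_or_gt D ρ with h | h
    · exact ⟨1, zero_le_one, le_rfl, by linarith, by rw [max_eq_left (by linarith)]; ring⟩
    · have hDpos : 0 < D := lt_of_le_of_lt hρ h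
      refine ⟨ρ / D, by positivity, (div_le_one hDpos).2 h.le, ?_, ?_⟩
      · rw [div_mul_cancel₀ _ hDpos.ne']
      · rw [max_eq_right (by linarith), sub_mul, div_mul_cancel₀ _ hDpos.ne', one_mul]
  let s : Fin M → ℝ := fun i => if 0 ≤ v i then 1 else -1
  have hs : ∀ i, |s i| = 1 := fun i => by simp only [s]; split_ifs <;> simp
  have hsv : ∀ i, v i = s i * |v i| := fun i => by
    simp only [s]
    split_ifs with h
    · rw [abs_of_nonneg h, one_mul]
    · rw [abs_of_neg (not_le.1 h)]; ring
  have hnn : ∀ i, 0 ≤ |v i| + l * (|a i| - |v i|) := fun i => by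
    nlinarith [abs_nonneg (a i), abs_nonneg (v i)]
  refine ⟨fun i => s i * (|v i| + l * (|a i| - |v i|)), ?_, ?_⟩
  · refine le_trans (euclNorm_le_of_abs_le (v := l • fun i => |a i| - |v i|) fun i => ?_) ?_
    · have : (v - fun i => s i * (|v i| + l * (|a i| - |v i|))) i =
          -(s i * (l * (|a i| - |v i|))) := by
        simp only [Pi.sub_apply]
        linear_combination hsv i
      rw [this, abs_neg, abs_mul, hs, one_mul]
      rfl
    · rw [euclNorm_smul, abs_of_nonneg hl0]
      exact hlρ
  · have : (fun i => |a i| - |s i * (|v i| + l * (|a i| - |v i|))|) =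
        (1 - l) • fun i => |a i| - |v i| := by
      funext i
      rw [abs_mul, hs, one_mul, abs_of_nonneg (hnn i)]
      simp only [Pi.smul_apply, smul_eq_mul]
      ring
    rw [this, euclNorm_smul, abs_of_nonneg (by linarith), hlD]

/-- For every `w` and `z` the inner maximum of the random dual is at least the squared positive part
of `gap`. -/
theorem iSup_dualFun_ge {M k : ℕ} (hM : 0 < M) {x r : ℝ}
    (G : (Fin M → Fin (k + 1) → ℝ) × (Fin M → ℝ) × (Fin k → ℝ))
    {w : EuclideanSpace ℝ (Fin k)} (hw : ‖w‖ = r) (z : EuclideanSpace ℝ (Fin M)) :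
    ((max 0 (gap x r (fun i => G.1 i 0) G.2.1 G.2.2) ^ 2 : ℝ) : EReal) ≤
      ⨆ ry ∈ Set.Ioi (0 : ℝ), ⨆ y ∈ {y : EuclideanSpace ℝ (Fin M) | ‖y‖ = ry},
        (dualFun x G w z y : EReal) := by
  rw [← EReal.ge_of_forall_gt_iff_ge]
  intro K hK
  rw [EReal.coe_lt_coe_iff] at hK
  suffices h : ∃ y : EuclideanSpace ℝ (Fin M), 0 < ‖y‖ ∧ K ≤ dualFun x G w z y by
    obtain ⟨y, hy, hKy⟩ := h
    refine le_trans (EReal.coe_le_coe_iff.2 hKy) ?_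
    exact le_iSup₂_of_le ‖y‖ hy (le_iSup₂_of_le y rfl le_rfl)
  set d : Fin M → ℝ := fun i => x * G.1 i 0 + r * G.2.1 i - z i with hd
  set q := ∑ j, w j * G.2.2 j with hq
  have hqge : -(r * euclNorm G.2.2) ≤ q := by
    have := neg_le_of_abs_le (abs_dot_le w.ofLp G.2.2)
    rwa [euclNorm_ofLp, hw] at this
  have hdual : ∀ y, dualFun x G w z y =
      euclNorm (fun i => |G.1 i 0| - |z i|) ^ 2 + ∑ i, y i * d i + q * ‖y‖ := fun y => by
    rw [dualFun_eq, hw, sq_euclNorm]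
  rcases le_or_gt (euclNorm d) (r * euclNorm G.2.2) with hle | hgt
  · have hbase : max 0 (gap x r (fun i => G.1 i 0) G.2.1 G.2.2) ≤
        euclNorm (fun i => |G.1 i 0| - |z i|) := by
      refine max_le (euclNorm_nonneg _) ?_
      rw [gap, sub_le_iff_le_add]
      have h1 : euclNorm (fun i => |G.1 i 0| - |x * G.1 i 0 + r * G.2.1 i|) ≤
          euclNorm (fun i => |G.1 i 0| - |z i|) +
            euclNorm (fun i => |z i| - |x * G.1 i 0 + r * G.2.1 i|) := by
        refine le_trans (le_of_eq ?_) (euclNorm_add_le _ _)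
        congr 1; funext i; simp
      have h2 : euclNorm (fun i => |z i| - |x * G.1 i 0 + r * G.2.1 i|) ≤ euclNorm d := by
        refine euclNorm_le_of_abs_le fun i => ?_
        rw [abs_sub_comm]
        exact abs_abs_sub_abs_le_abs_sub _ _
      linarith
    have hbase2 := pow_le_pow_left₀ (le_max_left _ _) hbase 2
    -- The value at `y = 0` is large enough, but `y = 0` is excluded: a short `y` comes close to it.
    set i₀ : Fin M := ⟨0, hM⟩
    set δ := (max 0 (gap x r (fun i => G.1 i 0) G.2.1 G.2.2) ^ 2 - K) / (1 + |d i₀ + q|) with hδ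
    have hδpos : 0 < δ := div_pos (by linarith) (by positivity)
    refine ⟨EuclideanSpace.single i₀ δ, by simpa using hδpos.ne', ?_⟩
    rw [hdual]
    have e1 : ∑ i, (EuclideanSpace.single i₀ δ : EuclideanSpace ℝ (Fin M)) i * d i = δ * d i₀ := by
      simp [PiLp.single_apply]
    have e2 : ‖(EuclideanSpace.single i₀ δ : EuclideanSpace ℝ (Fin M))‖ = δ := by
      simp [abs_of_pos hδpos]
    rw [e1, e2]
    have h3 : δ * (1 + |d i₀ + q|) =
        max 0 (gap x r (fun i => G.1 i 0) G.2.1 G.2.2) ^ 2 - K :=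
      div_mul_cancel₀ _ (by positivity)
    nlinarith [neg_abs_le (d i₀ + q)]
  · have hdpos : 0 < euclNorm d :=
      lt_of_le_of_lt (mul_nonneg (hw ▸ norm_nonneg _) (euclNorm_nonneg _)) hgt
    -- The maximum is `⊤`, along the ray spanned by `d`.
    set e := euclNorm d * (euclNorm d - r * euclNorm G.2.2) with he
    have hepos : 0 < e := mul_pos hdpos (by linarith)
    have hτ : 0 < (|K| + 1) / e := by positivity
    have hnorm : ‖(WithLp.toLp 2 (((|K| + 1) / e) • d) : EuclideanSpace ℝ (Fin M))‖ =
        (|K| + 1) / e * euclNorm d := by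
      rw [← euclNorm_eq_norm, euclNorm_smul, abs_of_pos hτ]
    refine ⟨WithLp.toLp 2 (((|K| + 1) / e) • d), by rw [hnorm]; positivity, ?_⟩
    rw [hdual, hnorm]
    have e1 : ∑ i, (WithLp.toLp 2 (((|K| + 1) / e) • d) : EuclideanSpace ℝ (Fin M)) i * d i =
        (|K| + 1) / e * euclNorm d ^ 2 := by
      simp only [Pi.smul_apply, smul_eq_mul, mul_assoc, ← sq]
      rw [← Finset.mul_sum, ← sq_euclNorm]
    rw [e1]
    have e2 : (|K| + 1) / e * e = |K| + 1 := div_mul_cancel₀ _ hepos.ne'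
    have e3 : (|K| + 1) / e * e ≤
        (|K| + 1) / e * euclNorm d ^ 2 + q * ((|K| + 1) / e * euclNorm d) := by
      have : (|K| + 1) / e * e ≤ (|K| + 1) / e * (euclNorm d * (euclNorm d + q)) :=
        mul_le_mul_of_nonneg_left (mul_le_mul_of_nonneg_left (by linarith) hdpos.le) hτ.le
      linarith
    have h0 := sq_nonneg (euclNorm (fun i => |G.1 i 0| - |z i|))
    linarith [le_abs_self K]

/-- The random dual in closed form. The maximum over `‖y‖` is finite only if
`‖x g⁽⁰⁾ + r g⁽¹⁾ - z‖ ≤ r ‖h⁽¹⁾‖` for the best `w`, and what remains is the squared distance of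
`|g⁽⁰⁾|` from the entrywise absolute values of that ball. -/
theorem frd_eq {M k : ℕ} (hM : 0 < M) (hk : 0 < k) (c x : ℝ)
    (G : (Fin M → Fin (k + 1) → ℝ) × (Fin M → ℝ) × (Fin k → ℝ)) :
    frd c x G = ((max 0 (gap x √(c - x ^ 2) (fun i => G.1 i 0) G.2.1 G.2.2) ^ 2 /
      ((k + 1 : ℕ) : ℝ) : ℝ) : EReal) := by
  rw [frd, EReal.coe_div]
  congr 1
  set r := √(c - x ^ 2) with hr
  have hr0 : 0 ≤ r := Real.sqrt_nonneg _
  refine le_antisymm ?_ (le_iInf₂ fun w hw => le_iInf fun z => iSup_dualFun_ge hM G hw z)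
  obtain ⟨w, hw, hwh⟩ := exists_norm_eq_dot_eq hk hr0 G.2.2
  obtain ⟨z, hz, hz2⟩ := exists_abs_approx (fun i => G.1 i 0)
    (fun i => x * G.1 i 0 + r * G.2.1 i) (mul_nonneg hr0 (euclNorm_nonneg G.2.2))
  refine (iInf₂_le w hw).trans ((iInf_le _ (WithLp.toLp 2 z)).trans
    (iSup₂_le fun ry _ => iSup₂_le fun y _ => ?_))
  rw [EReal.coe_le_coe_iff, dualFun_eq, hw, hwh, gap, ← hz2, sq_euclNorm]
  have h1 := le_of_abs_le (abs_dot_le y.ofLp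
    ((fun i => x * G.1 i 0 + r * G.2.1 i) - z))
  rw [euclNorm_ofLp] at h1
  have h2 := mul_le_mul_of_nonneg_left hz (norm_nonneg y)
  simp only [Pi.sub_apply] at h1
  have h3 : ∑ i, y i * (x * G.1 i 0 + r * G.2.1 i - z i) ≤ ‖y‖ * (r * euclNorm G.2.2) :=
    h1.trans h2
  simp only
  linarith

theorem uniquelySolvable_of_fpro_pos {M n : ℕ} {A : Fin M → Fin n → ℝ}
    {xbar : EuclideanSpace ℝ (Fin n)} (hxbar : ‖xbar‖ = 1)
    (h : ∀ c' x' : ℝ, ¬(c' = 1 ∧ (x' = 1 ∨ x' = -1)) → 0 < fpro c' x' A xbar) :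
    UniquelySolvable A xbar := by
  intro u hu
  by_cases hc : ‖u‖ ^ 2 = 1 ∧ (inner ℝ u xbar = 1 ∨ inner ℝ u xbar = -1)
  · have hu1 : ‖u‖ = 1 :=
      (pow_eq_one_iff_of_nonneg (norm_nonneg u) two_ne_zero).1 hc.1
    rcases hc.2 with h1 | h1
    · left
      exact (inner_eq_one_iff_of_norm_eq_one hu1 hxbar).1 h1
    · right
      have h2 : inner ℝ u (-xbar) = 1 := by rw [inner_neg_right, h1, neg_neg]
      exact (inner_eq_one_iff_of_norm_eq_one hu1 (by rwa [norm_neg])).1 h2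
  · exfalso
    refine absurd (h _ _ hc) (not_lt.2 ?_)
    refine (iInf₂_le (u, WithLp.toLp 2 (meas A u)) ⟨fun i => rfl, rfl, rfl⟩).trans ?_
    rw [← EReal.coe_zero, EReal.coe_le_coe_iff]
    refine le_of_eq (Finset.sum_eq_zero fun i _ => ?_)
    have : |meas A xbar i| = |meas A u i| :=
      ((pow_left_inj₀ (abs_nonneg _) (abs_nonneg _) two_ne_zero).1 (hu i)).symm
    simp [this]

/-! ### Rotation invariance -/

/-- The matrix `A U`, for an isometry `U` of `ℝ^n`. -/
noncomputable def rotate {M n : ℕ} (U : EuclideanSpace ℝ (Fin n) ≃ₗᵢ[ℝ] EuclideanSpace ℝ (Fin n))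
    (A : Fin M → Fin n → ℝ) : Fin M → Fin n → ℝ :=
  fun i => (U.symm (WithLp.toLp 2 (A i))).ofLp

theorem meas_eq_inner {M n : ℕ} (A : Fin M → Fin n → ℝ) (u : EuclideanSpace ℝ (Fin n)) (i : Fin M) :
    meas A u i = inner ℝ u (WithLp.toLp 2 (A i)) := by
  simp [meas, PiLp.inner_apply]

theorem meas_rotate {M n : ℕ} (U : EuclideanSpace ℝ (Fin n) ≃ₗᵢ[ℝ] EuclideanSpace ℝ (Fin n))
    (A : Fin M → Fin n → ℝ) (u : EuclideanSpace ℝ (Fin n)) (i : Fin M) :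
    meas (rotate U A) u i = meas A (U u) i := by
  rw [meas_eq_inner, meas_eq_inner, rotate, WithLp.toLp_ofLp, ← U.inner_map_map,
    LinearIsometryEquiv.apply_symm_apply]

theorem measurePreserving_rotate {M n : ℕ}
    (U : EuclideanSpace ℝ (Fin n) ≃ₗᵢ[ℝ] EuclideanSpace ℝ (Fin n)) :
    MeasurePreserving (rotate (M := M) U) (gaussMatrix M n) (gaussMatrix M n) := by
  have hto : MeasurePreserving (WithLp.toLp 2) (Measure.pi fun _ : Fin n => gaussianReal 0 1)
      (stdGaussian (EuclideanSpace ℝ (Fin n))) :=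
    ⟨by fun_prop, map_pi_eq_stdGaussian⟩
  have hU : MeasurePreserving U.symm (stdGaussian (EuclideanSpace ℝ (Fin n)))
      (stdGaussian (EuclideanSpace ℝ (Fin n))) :=
    ⟨U.symm.continuous.measurable, stdGaussian_map U.symm⟩
  have hof : MeasurePreserving (MeasurableEquiv.toLp 2 (Fin n → ℝ)).symm
      (stdGaussian (EuclideanSpace ℝ (Fin n))) (Measure.pi fun _ : Fin n => gaussianReal 0 1) :=
    MeasurePreserving.symm (MeasurableEquiv.toLp 2 (Fin n → ℝ)) hto
  exact measurePreserving_pi _ _ fun _ => hof.comp (hU.comp hto)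

theorem fpro_rotate_le {M n : ℕ} (c x : ℝ)
    (U : EuclideanSpace ℝ (Fin n) ≃ₗᵢ[ℝ] EuclideanSpace ℝ (Fin n))
    (A : Fin M → Fin n → ℝ) (e : EuclideanSpace ℝ (Fin n)) :
    fpro c x (rotate U A) e ≤ fpro c x A (U e) := by
  refine le_iInf₂ fun p hp => ?_
  obtain ⟨hz, hx, hc⟩ := hp
  refine (iInf₂_le (U.symm p.1, p.2) ⟨fun i => ?_, ?_, ?_⟩).trans (le_of_eq ?_)
  rotate_left
  · rw [meas_rotate, LinearIsometryEquiv.apply_symm_apply, hz]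
  · rw [← U.inner_map_map, LinearIsometryEquiv.apply_symm_apply, hx]
  · rw [U.symm.norm_map, hc]
  · simp_rw [meas_rotate]

theorem exists_isometry_apply_eq {E : Type*} [NormedAddCommGroup E] [InnerProductSpace ℝ E]
    [CompleteSpace E] {e v : E} (h : ‖e‖ = ‖v‖) : ∃ U : E ≃ₗᵢ[ℝ] E, U e = v :=
  ⟨Submodule.reflection (ℝ ∙ (e - v))ᗮ, Submodule.reflection_sub h⟩

/-! ### Almost sure uniqueness when there are more measurements than unknowns -/

theorem gaussVector_hyperplane {n : ℕ} {v : Fin n → ℝ} (hv : v ≠ 0) :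
    gaussVector n {a | ∑ j, a j * v j = 0} = 0 := by
  obtain ⟨p, hp⟩ := Function.ne_iff.1 hv
  have hS : MeasurableSet {a : Fin n → ℝ | ∑ j, a j * v j = 0} :=
    (isClosed_eq (by fun_prop) continuous_const).measurableSet
  have hmp := measurePreserving_update p (gaussianReal 0 1)
  rw [gaussVector, ← hmp.measure_preimage hS.nullMeasurableSet,
    Measure.measure_prod_null (hmp.measurable hS)]
  refine ae_of_all _ fun a => ?_
  have : NullSingletonClass (gaussianReal 0 1) := nullSingletonClass_gaussianReal one_ne_zero
  refine Set.Subsingleton.measure_zero (fun s hs t ht => ?_) _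
  have e : ∀ s : ℝ, ∑ j, Function.update a p s j * v j =
      s * v p + ∑ j ∈ Finset.univ.erase p, a j * v j := by
    intro s
    rw [← Finset.add_sum_erase Finset.univ _ (Finset.mem_univ p), Function.update_self]
    congr 1
    exact Finset.sum_congr rfl fun j hj => by
      rw [Function.update_of_ne (Finset.ne_of_mem_erase hj)]
  have hs' : ∑ j, Function.update a p s j * v j = 0 := hs
  have ht' : ∑ j, Function.update a p t j * v j = 0 := ht
  rw [e] at hs' ht'
  exact mul_right_cancel₀ hp (by linarith)

theorem gaussVector_submodule {n : ℕ} {p : Submodule ℝ (Fin n → ℝ)} (hp : p ≠ ⊤) :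
    gaussVector n {a | a ∈ p} = 0 := by
  obtain ⟨f, hf, hpf⟩ := Submodule.exists_le_ker_of_lt_top p (lt_top_iff_ne_top.2 hp)
  have hv : (fun j => f (Pi.single j 1)) ≠ 0 := by
    intro h
    refine hf (LinearMap.pi_ext' fun j => LinearMap.ext_ring ?_)
    simpa using congrFun h j
  refine measure_mono_null (fun a ha => ?_) (gaussVector_hyperplane hv)
  have h0 : f a = 0 := hpf ha
  change ∑ j, a j * f (Pi.single j 1) = 0
  rw [LinearMap.pi_apply_eq_sum_univ f a] at h0
  convert h0 using 3 with j
  rw [smul_eq_mul]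
  congr 3
  ext i
  simp [Pi.single_apply, eq_comm]

theorem measurePreserving_cons (m n : ℕ) :
    MeasurePreserving (fun p : (Fin m → Fin n → ℝ) × (Fin n → ℝ) =>
      (Fin.cons p.2 p.1 : Fin (m + 1) → Fin n → ℝ))
      ((gaussMatrix m n).prod (gaussVector n)) (gaussMatrix (m + 1) n) := by
  have h := (measurePreserving_piFinSuccAbove (fun _ : Fin (m + 1) => gaussVector n) 0).symm
  have h' := h.comp (Measure.measurePreserving_swap (μ := gaussMatrix m n) (ν := gaussVector n))
  have e : (fun p : (Fin m → Fin n → ℝ) × (Fin n → ℝ) =>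
      (Fin.cons p.2 p.1 : Fin (m + 1) → Fin n → ℝ)) =
      (MeasurableEquiv.piFinSuccAbove (fun _ : Fin (m + 1) => Fin n → ℝ) 0).symm ∘ Prod.swap :=
    funext fun p => (Fin.insertNth_zero' p.2 p.1).symm
  rw [e]
  exact h'

theorem measurePreserving_uncons (m n : ℕ) :
    MeasurePreserving (fun A : Fin (m + 1) → Fin n → ℝ =>
      ((fun i => A i.succ, A 0) : (Fin m → Fin n → ℝ) × (Fin n → ℝ)))
      (gaussMatrix (m + 1) n) ((gaussMatrix m n).prod (gaussVector n)) := by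
  have h := measurePreserving_piFinSuccAbove (fun _ : Fin (m + 1) => gaussVector n) 0
  exact Measure.measurePreserving_swap.comp h

theorem measurePreserving_tail (m n : ℕ) :
    MeasurePreserving (fun (A : Fin (m + 1) → Fin n → ℝ) i => A i.succ)
      (gaussMatrix (m + 1) n) (gaussMatrix m n) :=
  measurePreserving_fst.comp (measurePreserving_uncons m n)

/-- Row by row: a Gaussian row almost surely avoids the proper subspace spanned by the others. -/
theorem ae_linearIndependent_gaussMatrix {n : ℕ} :
    ∀ {j : ℕ}, j ≤ n → ∀ᵐ A ∂(gaussMatrix j n), LinearIndependent ℝ A := by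
  intro j
  induction j with
  | zero => exact fun _ => ae_of_all _ fun A => linearIndependent_empty_type
  | succ j ih =>
    intro hj
    have hmeas : MeasurableSet {A : Fin (j + 1) → Fin n → ℝ | LinearIndependent ℝ A} :=
      isOpen_setOfPred_linearIndependent.measurableSet
    have hmp := measurePreserving_cons j n
    rw [ae_iff]
    have hmeas' : MeasurableSet {A : Fin (j + 1) → Fin n → ℝ | ¬LinearIndependent ℝ A} :=
      hmeas.compl
    rw [← hmp.measure_preimage hmeas'.nullMeasurableSet,
      Measure.measure_prod_null (hmp.measurable hmeas')]
    filter_upwards [ih (by omega)] with B hB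
    have hspan : Submodule.span ℝ (Set.range B) ≠ ⊤ := by
      intro h
      have h1 := finrank_span_eq_card hB
      rw [h, finrank_top] at h1
      simp at h1
      omega
    refine measure_mono_null (fun a ha => ?_) (gaussVector_submodule hspan)
    by_contra hna
    exact ha (linearIndependent_finCons.2 ⟨hB, hna⟩)

theorem ae_det_gaussMatrix_ne_zero (n : ℕ) :
    ∀ᵐ A ∂(gaussMatrix n n), Matrix.det (Matrix.of A) ≠ 0 := by
  filter_upwards [ae_linearIndependent_gaussMatrix le_rfl] with A hA
  have : IsUnit (Matrix.of A) := Matrix.linearIndependent_rows_iff_isUnit.1 hA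
  exact ((Matrix.isUnit_iff_isUnit_det _).1 this).ne_zero

/-- The signs `± 1`, encoded by booleans. -/
noncomputable def boolSign (b : Bool) : ℝ := if b then 1 else -1

theorem exists_boolSign_mul_eq {p q : ℝ} (h : |p| ^ 2 = |q| ^ 2) : ∃ b, p = boolSign b * q := by
  rw [sq_abs, sq_abs, sq_eq_sq_iff_eq_or_eq_neg] at h
  rcases h with h | h
  · exact ⟨true, by simp [boolSign, h]⟩
  · exact ⟨false, by simp [boolSign, h]⟩

/-- `det B • (u - s y)` for the solution `u` of `B u = σ (B y)`. The adjugate makes it a continuous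
function of `B`, singular `B` included. -/
noncomputable def signDefect {n : ℕ} (y : Fin n → ℝ) (σ : Fin n → Bool) (s : Bool)
    (B : Fin n → Fin n → ℝ) :
    Fin n → ℝ :=
  (Matrix.of B).adjugate *ᵥ (fun i => boolSign (σ i) * (Matrix.of B *ᵥ y) i) -
    (Matrix.of B).det • (boolSign s • y)

theorem continuous_signDefect {n : ℕ} (y : Fin n → ℝ) (σ : Fin n → Bool) (s : Bool) :
    Continuous (signDefect y σ s) := by
  have h : Continuous fun B : Fin n → Fin n → ℝ => Matrix.of B := continuous_id
  unfold signDefect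
  refine (h.matrix_adjugate.matrix_mulVec (continuous_pi fun i => continuous_const.mul ?_)).sub
    (h.matrix_det.smul continuous_const)
  exact (continuous_apply i).comp (h.matrix_mulVec continuous_const)

/-- With one measurement more than unknowns, the first `n` rows determine every candidate `u` up to
finitely many choices, and the independent last row rejects all candidates but `± xbar`. -/
theorem ae_uniquelySolvable_succ {n : ℕ} (xbar : EuclideanSpace ℝ (Fin n)) :
    ∀ᵐ A ∂(gaussMatrix (n + 1) n), UniquelySolvable A xbar := by
  have h1 : ∀ᵐ p ∂((gaussMatrix n n).prod (gaussVector n)),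
      ∀ (σ : Fin n → Bool) (s : Bool), ∑ j, p.2 j * signDefect xbar.ofLp σ s p.1 j = 0 →
        signDefect xbar.ofLp σ s p.1 = 0 := by
    rw [ae_all_iff]; intro σ
    rw [ae_all_iff]; intro s
    rw [ae_iff]
    have hc := continuous_signDefect xbar.ofLp σ s
    have hS : MeasurableSet {p : (Fin n → Fin n → ℝ) × (Fin n → ℝ) |
        ¬(∑ j, p.2 j * signDefect xbar.ofLp σ s p.1 j = 0 → signDefect xbar.ofLp σ s p.1 = 0)} := by
      simp only [Classical.not_imp]
      refine MeasurableSet.inter (s₁ := {p : (Fin n → Fin n → ℝ) × (Fin n → ℝ) |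
        ∑ j, p.2 j * signDefect xbar.ofLp σ s p.1 j = 0}) ?_
        (isClosed_eq (hc.comp continuous_fst) continuous_const).measurableSet.compl
      exact (isClosed_eq (by fun_prop) continuous_const).measurableSet
    rw [Measure.measure_prod_null hS]
    refine ae_of_all _ fun B => ?_
    by_cases hB : signDefect xbar.ofLp σ s B = 0
    · refine measure_mono_null (fun a ha => ?_) measure_empty
      exact absurd (fun _ => hB) ha
    · refine measure_mono_null (fun a ha => ?_) (gaussVector_hyperplane hB)
      exact (Classical.not_imp.1 ha).1
  have h2 : ∀ᵐ p ∂((gaussMatrix n n).prod (gaussVector n)), Matrix.det (Matrix.of p.1) ≠ 0 :=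
    Measure.quasiMeasurePreserving_fst.ae (ae_det_gaussMatrix_ne_zero n)
  have h3 : ∀ᵐ p ∂((gaussMatrix n n).prod (gaussVector n)),
      UniquelySolvable (Fin.cons p.2 p.1 : Fin (n + 1) → Fin n → ℝ) xbar := by
    filter_upwards [h1, h2] with p hp1 hp2 u hu
    obtain ⟨s, hs⟩ := exists_boolSign_mul_eq (hu 0)
    choose σ hσ using fun i : Fin n => exists_boolSign_mul_eq (hu i.succ)
    have hBu : (fun i => boolSign (σ i) * (Matrix.of p.1 *ᵥ xbar.ofLp) i) =
        Matrix.of p.1 *ᵥ u.ofLp := by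
      funext i
      exact (hσ i).symm
    have hdef : signDefect xbar.ofLp σ s p.1 =
        (Matrix.of p.1).det • (u.ofLp - boolSign s • xbar.ofLp) := by
      rw [signDefect, hBu, Matrix.mulVec_mulVec, Matrix.adjugate_mul, Matrix.smul_mulVec,
        Matrix.one_mulVec, smul_sub]
    have hzero : ∑ j, p.2 j * signDefect xbar.ofLp σ s p.1 j = 0 := by
      rw [hdef]
      have hs' : ∑ j, p.2 j * u j = boolSign s * ∑ j, p.2 j * xbar j := hs
      have : ∀ j, p.2 j * ((Matrix.of p.1).det • (u.ofLp - boolSign s • xbar.ofLp)) j =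
          (Matrix.of p.1).det * (p.2 j * u j - boolSign s * (p.2 j * xbar j)) := fun j => by
        simp only [Pi.smul_apply, Pi.sub_apply, smul_eq_mul]; ring
      simp_rw [this]
      rw [← Finset.mul_sum, Finset.sum_sub_distrib, ← Finset.mul_sum, hs', sub_self, mul_zero]
    have := hp1 σ s hzero
    rw [hdef, smul_eq_zero_iff_right hp2, sub_eq_zero] at this
    cases s
    · right
      ext j
      simpa [boolSign] using congrFun this j
    · left
      ext j
      simpa [boolSign] using congrFun this j
  filter_upwards [(measurePreserving_uncons n n).quasiMeasurePreserving.ae h3] with A hA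
  have e : (Fin.cons (A 0) (fun i => A i.succ) : Fin (n + 1) → Fin n → ℝ) = A :=
    Fin.cons_self_tail A
  rwa [e] at hA

/-- Further measurements only restrict the candidates. -/
theorem ae_uniquelySolvable {m n : ℕ} (hmn : n + 1 ≤ m) (xbar : EuclideanSpace ℝ (Fin n)) :
    ∀ᵐ A ∂(gaussMatrix m n), UniquelySolvable A xbar := by
  induction m, hmn using Nat.le_induction with
  | base => exact ae_uniquelySolvable_succ xbar
  | succ m _ ih =>
    filter_upwards [(measurePreserving_tail m n).quasiMeasurePreserving.ae ih] with A hA u hu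
    exact hA u fun i => hu i.succ

/-! ### The law of large numbers for the random dual -/

theorem integral_abs_le_sqrt {Ω : Type*} [MeasurableSpace Ω] {μ : Measure Ω}
    [IsProbabilityMeasure μ] {X : Ω → ℝ} (hX : MemLp X 2 μ) :
    ∫ ω, |X ω| ∂μ ≤ √(∫ ω, X ω ^ 2 ∂μ) := by
  refine Real.le_sqrt_of_sq_le ?_
  have h := variance_nonneg (fun ω => |X ω|) μ
  rw [variance_eq_sub (by simpa [Real.norm_eq_abs] using! hX.norm)] at h
  simp only [Pi.pow_apply, sq_abs] at h
  linarith

/-- Chebyshev's argument for a sum of `M` iid square-integrable terms, in `L¹` form. -/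
theorem integral_abs_sum_sub_le {S : Type*} [MeasurableSpace S] {P : Measure S}
    [IsProbabilityMeasure P] {f : S → ℝ} (hf : MemLp f 2 P) (M : ℕ) :
    Integrable (fun s : Fin M → S => ∑ i, f (s i) - M * ∫ y, f y ∂P) (Measure.pi fun _ => P) ∧
    ∫ s, |∑ i, f (s i) - M * ∫ y, f y ∂P| ∂(Measure.pi fun _ : Fin M => P) ≤ √(M * Var[f; P]) := by
  have hev : ∀ i : Fin M, MemLp (fun s : Fin M → S => f (s i)) 2 (Measure.pi fun _ => P) :=
    fun i => hf.comp_measurePreserving (measurePreserving_eval (fun _ : Fin M => P) i)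
  have hsum : MemLp (fun s : Fin M → S => ∑ i, f (s i)) 2 (Measure.pi fun _ => P) :=
    memLp_finsetSum _ fun i _ => hev i
  have hmean : ∫ s, ∑ i, f (s i) ∂(Measure.pi fun _ : Fin M => P) = M * ∫ y, f y ∂P := by
    rw [integral_finsetSum _ fun i _ => (hev i).integrable (by norm_num)]
    simp_rw [fun i : Fin M => integral_comp_of_measurePreserving
      (measurePreserving_eval (fun _ : Fin M => P) i) hf.aestronglyMeasurable]
    simp
  have hX : MemLp (fun s : Fin M → S => ∑ i, f (s i) - M * ∫ y, f y ∂P) 2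
      (Measure.pi fun _ => P) := hsum.sub (memLp_const _)
  refine ⟨hX.integrable (by norm_num), (integral_abs_le_sqrt hX).trans (le_of_eq ?_)⟩
  have hvar := variance_sum_pi (μ := fun _ : Fin M => P) (X := fun _ => f) fun _ => hf
  rw [variance_eq_integral (by
    simpa [Finset.sum_fn] using! hsum.aestronglyMeasurable.aemeasurable)] at hvar
  simp only [Finset.sum_apply, hmean, Finset.sum_const, Finset.card_univ, Fintype.card_fin,
    nsmul_eq_mul] at hvar
  rw [hvar]

/-- The law of a pair of independent standard normal variables. -/
noncomputable def gaussPair : Measure (ℝ × ℝ) := (gaussianReal 0 1).prod (gaussianReal 0 1)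

instance : IsProbabilityMeasure gaussPair := by unfold gaussPair; infer_instance

instance : IsGaussian gaussPair := by unfold gaussPair; infer_instance

/-- The squared coordinate `(|a| - |x a + r b|)²` of `|g⁽⁰⁾| - |x g⁽⁰⁾ + r g⁽¹⁾|`. -/
noncomputable def coordSq (x r : ℝ) (p : ℝ × ℝ) : ℝ := (|p.1| - |x * p.1 + r * p.2|) ^ 2

/-- The mean of `coordSq x r` under the standard normal law. -/
noncomputable def kappa (x r : ℝ) : ℝ := ∫ p, coordSq x r p ∂gaussPair

theorem kappa_nonneg (x r : ℝ) : 0 ≤ kappa x r := integral_nonneg fun _ => sq_nonneg _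

@[fun_prop]
theorem continuous_coordSq (x r : ℝ) : Continuous (coordSq x r) := by
  unfold coordSq; fun_prop

theorem integrable_norm_pow_four {E : Type*} [NormedAddCommGroup E] [NormedSpace ℝ E]
    [MeasurableSpace E] [BorelSpace E] [SecondCountableTopology E] [CompleteSpace E]
    (μ : Measure E) [IsGaussian μ] : Integrable (fun p : E => ‖p‖ ^ 4) μ := by
  have := (IsGaussian.memLp_id μ 4 (by norm_num)).integrable_norm_pow (by norm_num)
  simpa using! this

theorem memLp_coordSq (x r : ℝ) : MemLp (coordSq x r) 2 gaussPair := by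
  rw [memLp_two_iff_integrable_sq (continuous_coordSq x r).aestronglyMeasurable]
  refine ((integrable_norm_pow_four gaussPair).const_mul ((1 + |x| + |r|) ^ 4)).mono'
    (by fun_prop) (ae_of_all _ fun p => ?_)
  rw [Real.norm_eq_abs, abs_of_nonneg (sq_nonneg _), coordSq, ← pow_mul, ← mul_pow]
  have h1 : |p.1| ≤ ‖p‖ := norm_fst_le p
  have h2 : |p.2| ≤ ‖p‖ := norm_snd_le p
  have h3 : |(|p.1| - |x * p.1 + r * p.2|)| ≤ (1 + |x| + |r|) * ‖p‖ := by
    have h4 : |x * p.1 + r * p.2| ≤ |x| * ‖p‖ + |r| * ‖p‖ := by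
      refine (abs_add_le _ _).trans ?_
      rw [abs_mul, abs_mul]
      gcongr
    rw [abs_le]
    constructor <;> nlinarith [abs_nonneg p.1, abs_nonneg (x * p.1 + r * p.2)]
  calc _ = |(|p.1| - |x * p.1 + r * p.2|)| ^ 4 := (Even.pow_abs (by decide) _).symm
    _ ≤ _ := pow_le_pow_left₀ (abs_nonneg _) h3 4

theorem memLp_sq_gaussianReal : MemLp (fun a : ℝ => a ^ 2) 2 (gaussianReal 0 1) := by
  rw [memLp_two_iff_integrable_sq (by fun_prop)]
  refine (integrable_norm_pow_four (gaussianReal 0 1)).congr (ae_of_all _ fun a => ?_)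
  simp only [Real.norm_eq_abs]
  rw [← pow_mul, Even.pow_abs (by decide)]

theorem integral_sq_gaussianReal : ∫ a, a ^ 2 ∂(gaussianReal 0 1) = 1 := by
  have := variance_fun_id_gaussianReal (μ := 0) (v := 1)
  rw [variance_eq_integral (by fun_prop)] at this
  simpa using this

theorem measurePreserving_pairs (M k : ℕ) :
    MeasurePreserving (fun (G : (Fin M → Fin (k + 1) → ℝ) × (Fin M → ℝ) × (Fin k → ℝ)) i =>
      (G.1 i 0, G.2.1 i)) (gaussTriple M k) (Measure.pi fun _ : Fin M => gaussPair) := by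
  have h1 := (measurePreserving_arrowProdEquivProdArrow ℝ ℝ (Fin M)
    (fun _ => gaussianReal 0 1) (fun _ => gaussianReal 0 1)).symm
  have h2 := (measurePreserving_col M k).prod
    (measurePreserving_fst (μ := gaussVector M) (ν := gaussVector k))
  exact h1.comp h2

theorem measurePreserving_snd_snd (M k : ℕ) :
    MeasurePreserving (fun G : (Fin M → Fin (k + 1) → ℝ) × (Fin M → ℝ) × (Fin k → ℝ) => G.2.2)
      (gaussTriple M k) (gaussVector k) :=
  measurePreserving_snd.comp measurePreserving_snd

/-- The quantity `gap`, rescaled by `√n`, on the probability space of `𝒢`. -/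
noncomputable def scaledGap {M k : ℕ} (x r : ℝ)
    (G : (Fin M → Fin (k + 1) → ℝ) × (Fin M → ℝ) × (Fin k → ℝ)) : ℝ :=
  gap x r (fun i => G.1 i 0) G.2.1 G.2.2 / √((k + 1 : ℕ) : ℝ)

theorem continuous_scaledGap {M k : ℕ} (x r : ℝ) :
    Continuous (scaledGap (M := M) (k := k) x r) := by
  unfold scaledGap
  exact ((continuous_gap x r).comp (f := fun
    G : (Fin M → Fin (k + 1) → ℝ) × (Fin M → ℝ) × (Fin k → ℝ) =>
      ((fun i => G.1 i 0 : Fin M → ℝ), G.2.1, G.2.2)) (by fun_prop)).div_const _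

theorem sq_sqrt_sub_sqrt_le {a b : ℝ} (ha : 0 ≤ a) (hb : 0 ≤ b) : (√a - √b) ^ 2 ≤ |a - b| := by
  have h1 := Real.sq_sqrt ha
  have h2 := Real.sq_sqrt hb
  have h3 := Real.sqrt_nonneg a
  have h4 := Real.sqrt_nonneg b
  rcases le_total (√a) (√b) with h | h
  · refine le_trans ?_ (neg_le_abs _)
    nlinarith
  · refine le_trans ?_ (le_abs_self _)
    nlinarith

/-- The mean squared distance of `scaledGap` from a constant `s`: two fluctuation terms, and the
bias of the norms replaced by the square roots of their mean squares. -/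
theorem integral_sq_scaledGap_le (M k : ℕ) (x r s : ℝ) :
    Integrable (fun G => (scaledGap x r G - s) ^ 2) (gaussTriple M k) ∧
    ∫ G, (scaledGap x r G - s) ^ 2 ∂(gaussTriple M k) ≤
      4 * (√(M * Var[coordSq x r; gaussPair]) / ((k + 1 : ℕ) : ℝ)) +
      4 * r ^ 2 * (√(k * Var[fun a : ℝ => a ^ 2; gaussianReal 0 1]) / ((k + 1 : ℕ) : ℝ)) +
      2 * ((√(M * kappa x r) - r * √k) / √((k + 1 : ℕ) : ℝ) - s) ^ 2 := by
  obtain ⟨i1, l1⟩ := integral_abs_sum_sub_le (memLp_coordSq x r) M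
  obtain ⟨i2, l2⟩ := integral_abs_sum_sub_le memLp_sq_gaussianReal k
  rw [← integral_comp_of_measurePreserving (measurePreserving_pairs M k)
    i1.abs.aestronglyMeasurable] at l1
  change Integrable _ (gaussVector k) at i2
  change ∫ s, _ ∂(gaussVector k) ≤ _ at l2
  rw [← integral_comp_of_measurePreserving (measurePreserving_snd_snd M k)
    i2.abs.aestronglyMeasurable] at l2
  have j1 := (measurePreserving_pairs M k).integrable_comp_of_integrable i1.abs
  have j2 := (measurePreserving_snd_snd M k).integrable_comp_of_integrable i2.abs
  rw [integral_sq_gaussianReal] at *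
  set n : ℝ := ((k + 1 : ℕ) : ℝ) with hn
  have hnpos : 0 < n := by rw [hn]; positivity
  set X₁ : (Fin M → Fin (k + 1) → ℝ) × (Fin M → ℝ) × (Fin k → ℝ) → ℝ := fun G =>
    |∑ i, coordSq x r (G.1 i 0, G.2.1 i) - M * ∫ y, coordSq x r y ∂gaussPair| with hX₁
  set X₂ : (Fin M → Fin (k + 1) → ℝ) × (Fin M → ℝ) × (Fin k → ℝ) → ℝ := fun G =>
    |∑ i, G.2.2 i ^ 2 - k * 1| with hX₂
  have j1' : Integrable X₁ (gaussTriple M k) := j1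
  have j2' : Integrable X₂ (gaussTriple M k) := j2
  have hpt : ∀ G, (scaledGap x r G - s) ^ 2 ≤ 4 / n * X₁ G + 4 * r ^ 2 / n * X₂ G +
      2 * ((√(M * kappa x r) - r * √k) / √n - s) ^ 2 := by
    intro G
    have h1 : (euclNorm (fun i => |G.1 i 0| - |x * G.1 i 0 + r * G.2.1 i|) -
        √(M * kappa x r)) ^ 2 ≤ X₁ G :=
      sq_sqrt_sub_sqrt_le (Finset.sum_nonneg fun _ _ => sq_nonneg _)
        (mul_nonneg (Nat.cast_nonneg _) (kappa_nonneg _ _))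
    have h2 : (euclNorm G.2.2 - √k) ^ 2 ≤ X₂ G := by
      simp only [hX₂, mul_one]
      exact sq_sqrt_sub_sqrt_le (Finset.sum_nonneg fun _ _ => sq_nonneg _) (Nat.cast_nonneg _)
    set P := euclNorm (fun i => |G.1 i 0| - |x * G.1 i 0 + r * G.2.1 i|) - √(M * kappa x r)
    set Q := euclNorm G.2.2 - √k
    set d := (√(M * kappa x r) - r * √k) / √n - s
    have e : scaledGap x r G - s = (P - r * Q) / √n + d := by
      simp only [scaledGap, gap, P, Q, d, ← hn]
      ring
    have e2 : ((P - r * Q) / √n) ^ 2 = (P - r * Q) ^ 2 / n := by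
      rw [div_pow, Real.sq_sqrt hnpos.le]
    have e3 : (P - r * Q) ^ 2 / n ≤ (2 * X₁ G + 2 * r ^ 2 * X₂ G) / n := by
      refine div_le_div_of_nonneg_right ?_ hnpos.le
      nlinarith [sq_nonneg (P + r * Q), mul_le_mul_of_nonneg_left h2 (sq_nonneg r)]
    have e4 : 4 / n * X₁ G + 4 * r ^ 2 / n * X₂ G = 2 * ((2 * X₁ G + 2 * r ^ 2 * X₂ G) / n) := by
      ring
    rw [e, e4]
    nlinarith [sq_nonneg ((P - r * Q) / √n - d)]
  have hint := ((j1'.const_mul (4 / n)).add (j2'.const_mul (4 * r ^ 2 / n))).add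
    (integrable_const (2 * ((√(M * kappa x r) - r * √k) / √n - s) ^ 2))
  have hI : Integrable (fun G => (scaledGap x r G - s) ^ 2) (gaussTriple M k) := by
    refine hint.mono' (((continuous_scaledGap x r).sub continuous_const).pow 2).aestronglyMeasurable
      (ae_of_all _ fun G => ?_)
    rw [Real.norm_eq_abs, abs_of_nonneg (sq_nonneg _)]
    exact hpt G
  refine ⟨hI, (integral_mono hI hint hpt).trans ?_⟩
  have e1 := integral_add ((j1'.const_mul (4 / n)).add (j2'.const_mul (4 * r ^ 2 / n)))
    (integrable_const (μ := gaussTriple M k)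
      (2 * ((√(M * kappa x r) - r * √k) / √n - s) ^ 2))
  have e2 := integral_add (j1'.const_mul (4 / n)) (j2'.const_mul (4 * r ^ 2 / n))
  rw [integral_const_mul, integral_const_mul] at e2
  refine (le_of_eq e1).trans ?_
  refine add_le_add ((le_of_eq e2).trans (add_le_add ?_ ?_)) (by simp)
  · rw [div_mul_eq_mul_div, mul_div_assoc]
    have : ∫ G, X₁ G ∂gaussTriple M k ≤ _ := l1
    gcongr
  · rw [div_mul_eq_mul_div, mul_div_assoc]
    have : ∫ G, X₂ G ∂gaussTriple M k ≤ _ := l2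
    gcongr

theorem tendsto_integral_sq_scaledGap {α : ℝ} {m : ℕ → ℕ}
    (hm : Tendsto (fun n : ℕ => (m n : ℝ) / (n : ℝ)) atTop (𝓝 α)) (x r : ℝ) :
    Tendsto (fun k : ℕ => ∫ G, (scaledGap x r G - (√(α * kappa x r) - r)) ^ 2
      ∂(gaussTriple (m (k + 1)) k)) atTop (𝓝 0) := by
  have hm' : Tendsto (fun k : ℕ => (m (k + 1) : ℝ) / ((k + 1 : ℕ) : ℝ)) atTop (𝓝 α) :=
    hm.comp (tendsto_add_atTop_nat 1)
  have hinv : Tendsto (fun k : ℕ => 1 / ((k + 1 : ℕ) : ℝ)) atTop (𝓝 0) := by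
    have := tendsto_one_div_add_atTop_nhds_zero_nat (𝕜 := ℝ)
    simpa using this
  have hk' : Tendsto (fun k : ℕ => (k : ℝ) / ((k + 1 : ℕ) : ℝ)) atTop (𝓝 1) := by
    have := hinv.const_sub 1
    rw [sub_zero] at this
    refine this.congr fun k => ?_
    push_cast
    field_simp
    ring
  have hsq : ∀ (a b n : ℝ), 0 < n → √(a * b) / n = √(a / n * (b * (1 / n))) := by
    intro a b n hn
    rw [show a / n * (b * (1 / n)) = a * b / n ^ 2 by field_simp,
      Real.sqrt_div' _ (by positivity), Real.sqrt_sq hn.le]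
  have l1 : Tendsto (fun k : ℕ => √((m (k + 1) : ℝ) * Var[coordSq x r; gaussPair]) /
      ((k + 1 : ℕ) : ℝ)) atTop (𝓝 0) := by
    have := (hm'.mul (hinv.const_mul (Var[coordSq x r; gaussPair]))).sqrt
    simp only [mul_zero, Real.sqrt_zero] at this
    exact this.congr fun k => (hsq _ _ _ (by positivity)).symm
  have l2 : Tendsto (fun k : ℕ => √((k : ℝ) * Var[fun a : ℝ => a ^ 2; gaussianReal 0 1]) /
      ((k + 1 : ℕ) : ℝ)) atTop (𝓝 0) := by
    have := (hk'.mul (hinv.const_mul (Var[fun a : ℝ => a ^ 2; gaussianReal 0 1]))).sqrt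
    simp only [mul_zero, Real.sqrt_zero] at this
    exact this.congr fun k => (hsq _ _ _ (by positivity)).symm
  have l3 : Tendsto (fun k : ℕ => (√((m (k + 1) : ℝ) * kappa x r) - r * √k) /
      √((k + 1 : ℕ) : ℝ)) atTop (𝓝 (√(α * kappa x r) - r)) := by
    have h1 := (hm'.mul_const (kappa x r)).sqrt
    have h2 := hk'.sqrt.const_mul r
    rw [Real.sqrt_one, mul_one] at h2
    refine (h1.sub h2).congr fun k => ?_
    rw [div_mul_eq_mul_div, Real.sqrt_div' _ (by positivity), Real.sqrt_div' _ (by positivity)]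
    ring
  have hub := ((l1.const_mul 4).add (l2.const_mul (4 * r ^ 2))).add
    (((l3.sub_const (√(α * kappa x r) - r)).pow 2).const_mul 2)
  simp only [mul_zero, sub_self, ne_eq, OfNat.ofNat_ne_zero, not_false_eq_true, zero_pow,
    add_zero] at hub
  exact squeeze_zero (fun k => integral_nonneg fun G => sq_nonneg _)
    (fun k => (integral_sq_scaledGap_le (m (k + 1)) k x r (√(α * kappa x r) - r)).2) hub

theorem tendsto_measure_scaledGap_lt {α : ℝ} {m : ℕ → ℕ}
    (hm : Tendsto (fun n : ℕ => (m n : ℝ) / (n : ℝ)) atTop (𝓝 α)) (x r : ℝ) {τ : ℝ}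
    (hτ : τ < √(α * kappa x r) - r) :
    Tendsto (fun k : ℕ => gaussTriple (m (k + 1)) k {G | scaledGap x r G < τ}) atTop (𝓝 0) := by
  set ω := √(α * kappa x r) - r with hω
  have hpos : 0 < (ω - τ) ^ 2 := by have := sub_pos.2 hτ; positivity
  have hub : Tendsto (fun k : ℕ => ENNReal.ofReal ((∫ G, (scaledGap x r G - ω) ^ 2
      ∂(gaussTriple (m (k + 1)) k)) / (ω - τ) ^ 2)) atTop (𝓝 0) := by
    have := ENNReal.tendsto_ofReal
      ((tendsto_integral_sq_scaledGap hm x r).div_const ((ω - τ) ^ 2))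
    simpa using this
  refine tendsto_of_tendsto_of_tendsto_of_le_of_le tendsto_const_nhds hub (fun _ => zero_le) ?_
  intro k
  have h := mul_meas_ge_le_integral_of_nonneg (μ := gaussTriple (m (k + 1)) k)
    (ae_of_all _ fun G => sq_nonneg (scaledGap x r G - ω))
    (integral_sq_scaledGap_le (m (k + 1)) k x r ω).1 ((ω - τ) ^ 2)
  have hsub : {G : (Fin (m (k + 1)) → Fin (k + 1) → ℝ) × (Fin (m (k + 1)) → ℝ) × (Fin k → ℝ) |
      scaledGap x r G < τ} ⊆ {G | (ω - τ) ^ 2 ≤ (scaledGap x r G - ω) ^ 2} := by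
    intro G hG
    have hG' : scaledGap x r G < τ := hG
    change (ω - τ) ^ 2 ≤ (scaledGap x r G - ω) ^ 2
    nlinarith
  refine (measure_mono hsub).trans ?_
  rw [← ofReal_measureReal]
  refine ENNReal.ofReal_le_ofReal ?_
  rw [le_div_iff₀ hpos, mul_comm]
  exact h

theorem tendsto_integral_sq_max_scaledGap {α : ℝ} {m : ℕ → ℕ}
    (hm : Tendsto (fun n : ℕ => (m n : ℝ) / (n : ℝ)) atTop (𝓝 α)) (x r : ℝ) :
    (∀ M k : ℕ, Integrable (fun G => max 0 (scaledGap x r G) ^ 2) (gaussTriple M k)) ∧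
    Tendsto (fun k : ℕ => ∫ G, max 0 (scaledGap x r G) ^ 2 ∂(gaussTriple (m (k + 1)) k))
      atTop (𝓝 (max 0 (√(α * kappa x r) - r) ^ 2)) := by
  set ω := √(α * kappa x r) - r with hω
  have hmemLp : ∀ M k : ℕ, MemLp (fun G => scaledGap x r G - ω) 2 (gaussTriple M k) := fun M k => by
    refine (memLp_two_iff_integrable_sq
      ((continuous_scaledGap x r).sub continuous_const).aestronglyMeasurable).2 ?_
    exact (integral_sq_scaledGap_le M k x r ω).1
  have hpt : ∀ t : ℝ, |max 0 t ^ 2 - max 0 ω ^ 2| ≤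
      (t - ω) ^ 2 + 2 * max 0 ω * |t - ω| := by
    intro t
    have h1 : |max 0 t - max 0 ω| ≤ |t - ω| := by
      have := abs_max_sub_max_le_abs t ω 0
      rwa [max_comm t, max_comm ω] at this
    have h2 : max 0 t ^ 2 - max 0 ω ^ 2 =
        (max 0 t - max 0 ω) ^ 2 + 2 * max 0 ω * (max 0 t - max 0 ω) := by ring
    have h3 : (0 : ℝ) ≤ max 0 ω := le_max_left _ _
    rw [h2]
    refine (abs_add_le _ _).trans (add_le_add ?_ ?_)
    · rw [abs_of_nonneg (sq_nonneg _)]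
      exact sq_le_sq.2 h1
    · rw [abs_mul, abs_of_nonneg (by positivity)]
      exact mul_le_mul_of_nonneg_left h1 (by positivity)
  have hbint : ∀ M k : ℕ, Integrable (fun G => (scaledGap x r G - ω) ^ 2 +
      2 * max 0 ω * |scaledGap x r G - ω|) (gaussTriple M k) := fun M k =>
    (integral_sq_scaledGap_le M k x r ω).1.add
      (((hmemLp M k).integrable (by norm_num)).abs.const_mul _)
  have hdint : ∀ M k : ℕ, Integrable (fun G => max 0 (scaledGap x r G) ^ 2 - max 0 ω ^ 2)
      (gaussTriple M k) := fun M k =>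
    (hbint M k).mono' (((continuous_const.max (continuous_scaledGap x r)).pow 2).sub
      continuous_const).aestronglyMeasurable (ae_of_all _ fun G => hpt _)
  have hint : ∀ M k : ℕ, Integrable (fun G => max 0 (scaledGap x r G) ^ 2) (gaussTriple M k) :=
    fun M k => ((hdint M k).add (integrable_const (max 0 ω ^ 2))).congr
      (ae_of_all _ fun G => by simp)
  refine ⟨hint, ?_⟩
  have hlim := tendsto_integral_sq_scaledGap hm x r
  rw [tendsto_iff_dist_tendsto_zero]
  have hub : Tendsto (fun k : ℕ =>
      (∫ G, (scaledGap x r G - ω) ^ 2 ∂(gaussTriple (m (k + 1)) k)) +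
      2 * max 0 ω * √(∫ G, (scaledGap x r G - ω) ^ 2 ∂(gaussTriple (m (k + 1)) k)))
      atTop (𝓝 0) := by
    have := hlim.add (hlim.sqrt.const_mul (2 * max 0 ω))
    simpa using this
  refine squeeze_zero (fun _ => dist_nonneg) (fun k => ?_) hub
  have e : ∫ G, max 0 (scaledGap x r G) ^ 2 ∂(gaussTriple (m (k + 1)) k) - max 0 ω ^ 2 =
      ∫ G, (max 0 (scaledGap x r G) ^ 2 - max 0 ω ^ 2) ∂(gaussTriple (m (k + 1)) k) := by
    rw [integral_sub (hint _ _) (integrable_const _)]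
    simp
  rw [Real.dist_eq, e]
  refine (abs_integral_le_integral_abs).trans
    ((integral_mono (hdint _ _).abs (hbint _ _) fun G => hpt _).trans ?_)
  rw [integral_add (integral_sq_scaledGap_le _ _ x r ω).1
    (((hmemLp _ _).integrable (by norm_num)).abs.const_mul _), integral_const_mul]
  have h3 : (0 : ℝ) ≤ max 0 ω := le_max_left _ _
  have := integral_abs_le_sqrt (hmemLp (m (k + 1)) k)
  gcongr

/-! ### The mean `kappa` on the unit sphere -/

theorem gaussPair_eq_withDensity : gaussPair = (volume : Measure (ℝ × ℝ)).withDensity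
    fun p => gaussianPDF 0 1 p.1 * gaussianPDF 0 1 p.2 := by
  rw [gaussPair, gaussianReal_of_var_ne_zero _ one_ne_zero,
    prod_withDensity (measurable_gaussianPDF 0 1) (measurable_gaussianPDF 0 1)]
  rfl

/-- Polar coordinates for functions that are homogeneous of degree `2`. -/
theorem exists_integral_gaussPair_eq : ∃ K : ℝ, ∀ f : ℝ × ℝ → ℝ,
    (∀ ρ p, f (ρ • p) = ρ ^ 2 * f p) →
      ∫ p, f p ∂gaussPair = K * ∫ θ in (-Real.pi)..Real.pi, f (Real.cos θ, Real.sin θ) := by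
  refine ⟨∫ ρ in Set.Ioi (0 : ℝ), ρ ^ 3 * (gaussianPDFReal 0 1 ρ * gaussianPDFReal 0 1 0),
    fun f hf => ?_⟩
  have hmeas : Measurable fun p : ℝ × ℝ => gaussianPDF 0 1 p.1 * gaussianPDF 0 1 p.2 :=
    ((measurable_gaussianPDF 0 1).comp measurable_fst).mul
      ((measurable_gaussianPDF 0 1).comp measurable_snd)
  rw [gaussPair_eq_withDensity, integral_withDensity_eq_integral_toReal_smul hmeas
    (ae_of_all _ fun p => ENNReal.mul_lt_top gaussianPDF_lt_top gaussianPDF_lt_top),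
    ← integral_comp_polarCoord_symm, polarCoord_target,
    intervalIntegral.integral_of_le (by linarith [Real.pi_pos]), integral_Ioc_eq_integral_Ioo,
    Measure.volume_eq_prod, ← setIntegral_prod_mul]
  refine setIntegral_congr_fun (measurableSet_Ioi.prod measurableSet_Ioo) fun p _ => ?_
  have h1 : polarCoord.symm p = p.1 • (Real.cos p.2, Real.sin p.2) := by
    simp [polarCoord_symm_apply]
  have h2 : gaussianPDFReal 0 1 (p.1 * Real.cos p.2) * gaussianPDFReal 0 1 (p.1 * Real.sin p.2) =
      gaussianPDFReal 0 1 p.1 * gaussianPDFReal 0 1 0 := by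
    simp only [gaussianPDFReal, sub_zero]
    have hmul : ∀ C a b : ℝ, C * Real.exp a * (C * Real.exp b) = C * C * Real.exp (a + b) :=
      fun C a b => by rw [Real.exp_add]; ring
    rw [hmul, hmul]
    congr 2
    have := Real.sin_sq_add_cos_sq p.2
    simp only [NNReal.coe_one]
    linear_combination (-(p.1 ^ 2) / 2) * this
  rw [h1, hf]
  simp only [Prod.smul_mk, smul_eq_mul, ENNReal.toReal_mul, toReal_gaussianPDF]
  rw [h2]
  ring

theorem integrable_sq_gaussPair : Integrable (fun p : ℝ × ℝ => p.1 ^ 2) gaussPair ∧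
    Integrable (fun p : ℝ × ℝ => p.2 ^ 2) gaussPair := by
  have h : Integrable (fun a : ℝ => a ^ 2) (gaussianReal 0 1) :=
    memLp_sq_gaussianReal.integrable (by norm_num)
  exact ⟨measurePreserving_fst.integrable_comp_of_integrable h,
    measurePreserving_snd.integrable_comp_of_integrable h⟩

theorem integral_sq_gaussPair : ∫ p, p.1 ^ 2 ∂gaussPair = 1 ∧ ∫ p, p.2 ^ 2 ∂gaussPair = 1 := by
  have h := memLp_sq_gaussianReal.aestronglyMeasurable
  refine ⟨?_, ?_⟩
  · rw [gaussPair, integral_comp_of_measurePreserving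
      (measurePreserving_fst (μ := gaussianReal 0 1) (ν := gaussianReal 0 1)) h,
      integral_sq_gaussianReal]
  · rw [gaussPair, integral_comp_of_measurePreserving
      (measurePreserving_snd (μ := gaussianReal 0 1) (ν := gaussianReal 0 1)) h,
      integral_sq_gaussianReal]

theorem integral_gaussPair_eq {f : ℝ × ℝ → ℝ} (hf : ∀ ρ p, f (ρ • p) = ρ ^ 2 * f p) :
    ∫ p, f p ∂gaussPair =
      Real.pi⁻¹ * ∫ θ in (-Real.pi)..Real.pi, f (Real.cos θ, Real.sin θ) := by
  obtain ⟨K, hK⟩ := exists_integral_gaussPair_eq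
  -- The constant is identified with the help of `f p = p.1 ^ 2 + p.2 ^ 2`.
  have h1 := hK (fun p => p.1 ^ 2 + p.2 ^ 2) fun ρ p => by
    simp only [Prod.smul_fst, Prod.smul_snd, smul_eq_mul]; ring
  rw [integral_add integrable_sq_gaussPair.1 integrable_sq_gaussPair.2,
    integral_sq_gaussPair.1, integral_sq_gaussPair.2] at h1
  simp only [Real.cos_sq_add_sin_sq, intervalIntegral.integral_const, smul_eq_mul] at h1
  have hpi := Real.pi_pos
  have : K = Real.pi⁻¹ := by
    refine eq_inv_of_mul_eq_one_left ?_
    linarith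
  rw [hK f hf, this]

theorem cos_ge_quadratic {x : ℝ} (hx0 : 0 ≤ x) (hx1 : x ≤ 1) :
    Real.pi * (1 - x ^ 2) / 4 ≤ Real.cos (Real.pi * x / 2) := by
  have hpi := Real.pi_pos
  have hpi2 := Real.pi_lt_d2
  set y := Real.pi * (1 - x) / 2 with hy
  have hy0 : 0 ≤ y := by rw [hy]; have := sub_nonneg.2 hx1; positivity
  have hcos : Real.cos (Real.pi * x / 2) = Real.sin y := by
    rw [← Real.sin_pi_div_two_sub]
    congr 1
    rw [hy]; ring
  have h1 := Real.sin_ge_sub_cube hy0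
  have h2 : Real.pi * (1 - x ^ 2) / 4 = y - y ^ 2 / Real.pi := by
    rw [hy]; field_simp; ring
  have h3 : y ^ 3 / 6 ≤ y ^ 2 / Real.pi := by
    rw [div_le_div_iff₀ (by norm_num) hpi]
    have : y * Real.pi ≤ 6 := by
      have : y ≤ Real.pi / 2 := by rw [hy]; nlinarith
      nlinarith
    nlinarith [sq_nonneg y]
  rw [hcos, h2]
  linarith

/-- Replacing `|cos φ + x|` by `± (cos φ + x)`, with a change of sign at `± π (1 + x) / 2`, loses
little enough. -/
theorem integral_abs_cos_add_ge {x : ℝ} (hx0 : 0 ≤ x) (hx1 : x ≤ 1) :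
    Real.pi * (1 + x ^ 2) ≤ ∫ φ in (-Real.pi)..Real.pi, |Real.cos φ + x| := by
  have hpi := Real.pi_pos
  set β := Real.pi / 2 + Real.pi * x / 2 with hβ
  have hβ0 : 0 ≤ β := by positivity
  have hβ1 : β ≤ Real.pi := by rw [hβ]; nlinarith
  have hint : ∀ a b, IntervalIntegrable (fun φ => |Real.cos φ + x|) volume a b := fun a b =>
    Continuous.intervalIntegrable (by fun_prop) a b
  have hcint : ∀ a b, IntervalIntegrable (fun φ => Real.cos φ + x) volume a b := fun a b =>
    Continuous.intervalIntegrable (by fun_prop) a b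
  have hval : ∀ a b, ∫ φ in a..b, (Real.cos φ + x) = Real.sin b - Real.sin a + (b - a) * x := by
    intro a b
    rw [intervalIntegral.integral_add (Real.continuous_cos.intervalIntegrable a b)
      intervalIntegrable_const]
    simp
  have h1 : -(∫ φ in (-Real.pi)..(-β), (Real.cos φ + x)) ≤
      ∫ φ in (-Real.pi)..(-β), |Real.cos φ + x| := by
    rw [← intervalIntegral.integral_neg]
    exact intervalIntegral.integral_mono_on (by linarith) (hcint _ _).neg (hint _ _)
      fun φ _ => neg_le_abs _
  have h2 : ∫ φ in (-β)..β, (Real.cos φ + x) ≤ ∫ φ in (-β)..β, |Real.cos φ + x| :=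
    intervalIntegral.integral_mono_on (by linarith) (hcint _ _) (hint _ _) fun φ _ => le_abs_self _
  have h3 : -(∫ φ in β..Real.pi, (Real.cos φ + x)) ≤ ∫ φ in β..Real.pi, |Real.cos φ + x| := by
    rw [← intervalIntegral.integral_neg]
    exact intervalIntegral.integral_mono_on hβ1 (hcint _ _).neg (hint _ _)
      fun φ _ => neg_le_abs _
  rw [hval] at h1 h2 h3
  rw [← intervalIntegral.integral_add_adjacent_intervals (hint _ (-β)) (hint _ _),
    ← intervalIntegral.integral_add_adjacent_intervals (hint (-β) β) (hint _ _)]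
  have hsin : Real.sin β = Real.cos (Real.pi * x / 2) := by
    rw [hβ, add_comm, Real.sin_add_pi_div_two]
  have hc := cos_ge_quadratic hx0 hx1
  simp only [Real.sin_neg, Real.sin_pi] at h1 h2 h3
  rw [hsin] at h1 h2 h3
  have e : β * x = Real.pi * x / 2 + Real.pi * x ^ 2 / 2 := by rw [hβ]; ring
  nlinarith

/-- With `x = cos ψ` and `r = sin ψ` the integrand is `|cos θ cos (θ - ψ)| = |cos (2θ - ψ) + x| / 2`
in polar coordinates. -/
theorem integral_abs_mul_ge {x r : ℝ} (hx0 : 0 ≤ x) (hr : 0 ≤ r) (hxr : x ^ 2 + r ^ 2 = 1) :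
    (1 + x ^ 2) / 2 ≤ ∫ p, |p.1| * |x * p.1 + r * p.2| ∂gaussPair := by
  have hpi := Real.pi_pos
  have hx1 : x ≤ 1 := by nlinarith [sq_nonneg r]
  rw [integral_gaussPair_eq (f := fun p => |p.1| * |x * p.1 + r * p.2|) fun ρ p => by
    simp only [Prod.smul_fst, Prod.smul_snd, smul_eq_mul]
    rw [show x * (ρ * p.1) + r * (ρ * p.2) = ρ * (x * p.1 + r * p.2) by ring, abs_mul, abs_mul,
      ← sq_abs ρ]
    ring]
  set ψ := Real.arccos x with hψ
  have hcψ : Real.cos ψ = x := Real.cos_arccos (by linarith) hx1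
  have hsψ : Real.sin ψ = r := by
    rw [hψ, Real.sin_arccos, ← hxr, add_sub_cancel_left, Real.sqrt_sq hr]
  have hpt : ∀ θ, |Real.cos θ| * |x * Real.cos θ + r * Real.sin θ| =
      2⁻¹ * |Real.cos (2 * θ - ψ) + x| := by
    intro θ
    rw [← abs_mul, ← abs_of_pos (by norm_num : (0 : ℝ) < 2⁻¹), ← abs_mul]
    congr 1
    rw [Real.cos_sub, Real.cos_two_mul, Real.sin_two_mul, hcψ, hsψ]
    ring
  simp only [hpt]
  have hper : Function.Periodic (fun φ => |Real.cos φ + x|) (2 * Real.pi) := fun φ => by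
    simp [Real.cos_add_two_pi]
  rw [intervalIntegral.integral_const_mul,
    intervalIntegral.integral_comp_mul_sub (fun φ => |Real.cos φ + x|) two_ne_zero]
  have h4 : 2 * Real.pi - ψ = (2 * -Real.pi - ψ) + (2 : ℤ) • (2 * Real.pi) := by
    simp; ring
  rw [h4, hper.intervalIntegral_add_zsmul_eq, hper.intervalIntegral_add_eq _ (-Real.pi),
    show -Real.pi + 2 * Real.pi = Real.pi by ring]
  · have key := integral_abs_cos_add_ge hx0 hx1
    simp only [smul_eq_mul, zsmul_eq_mul, Int.cast_ofNat]
    rw [inv_mul_eq_div, le_div_iff₀ hpi]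
    linarith
  · exact fun a b => Continuous.intervalIntegrable (by fun_prop) a b

/-- On the unit sphere `kappa x r ≤ r ^ 2`: the expectation of
`|g| |x g + r g'|` is at least `(1 + x ^ 2) / 2`. -/
theorem kappa_le {x r : ℝ} (hx0 : 0 ≤ x) (hr : 0 ≤ r) (hxr : x ^ 2 + r ^ 2 = 1) :
    kappa x r ≤ r ^ 2 := by
  have hv : ∀ p : ℝ × ℝ, coordSq x r p = (p.1 ^ 2 + (x * p.1 + r * p.2) ^ 2) -
      2 * (|p.1| * |x * p.1 + r * p.2|) := fun p => by
    rw [coordSq, ← sq_abs p.1, ← sq_abs (x * p.1 + r * p.2)]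
    ring
  have hid : ∀ p : ℝ × ℝ, p.1 ^ 2 + (x * p.1 + r * p.2) ^ 2 + (x * p.2 - r * p.1) ^ 2 =
      2 * p.1 ^ 2 + p.2 ^ 2 := fun p => by linear_combination (p.1 ^ 2 + p.2 ^ 2) * hxr
  have hmul : Integrable (fun p : ℝ × ℝ => p.1 * p.2) gaussPair := by
    refine (integrable_sq_gaussPair.1.add integrable_sq_gaussPair.2).mono'
      (by fun_prop) (ae_of_all _ fun p => ?_)
    simp only [Pi.add_apply]
    rw [Real.norm_eq_abs, abs_le]
    constructor <;> nlinarith [sq_nonneg (p.1 + p.2), sq_nonneg (p.1 - p.2)]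
  have hmul0 : ∫ p, p.1 * p.2 ∂gaussPair = 0 := by
    rw [gaussPair, integral_prod_mul (fun a : ℝ => a) (fun b : ℝ => b)]
    simp [integral_id_gaussianReal]
  have hq : ∀ p : ℝ × ℝ, p.1 ^ 2 + (x * p.1 + r * p.2) ^ 2 =
      (1 + x ^ 2) * p.1 ^ 2 + r ^ 2 * p.2 ^ 2 + 2 * x * r * (p.1 * p.2) := fun p => by ring
  have i1 := (integrable_sq_gaussPair.1.const_mul (1 + x ^ 2))
  have i2 := (integrable_sq_gaussPair.2.const_mul (r ^ 2))
  have i3 := hmul.const_mul (2 * x * r)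
  have hqi : Integrable (fun p : ℝ × ℝ => p.1 ^ 2 + (x * p.1 + r * p.2) ^ 2) gaussPair := by
    simp_rw [hq]; exact (i1.add i2).add i3
  have hqe : ∫ p, (p.1 ^ 2 + (x * p.1 + r * p.2) ^ 2) ∂gaussPair = 2 := by
    simp_rw [hq]
    have e1 := integral_add (i1.add i2) i3
    have e2 := integral_add i1 i2
    refine e1.trans ?_
    refine (congrArg (· + _) e2).trans ?_
    rw [integral_const_mul, integral_const_mul, integral_const_mul, integral_sq_gaussPair.1,
      integral_sq_gaussPair.2, hmul0]
    linear_combination hxr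
  have hai : Integrable (fun p : ℝ × ℝ => |p.1| * |x * p.1 + r * p.2|) gaussPair := by
    refine hqi.mono' (by fun_prop) (ae_of_all _ fun p => ?_)
    rw [Real.norm_eq_abs, abs_of_nonneg (by positivity), ← sq_abs p.1,
      ← sq_abs (x * p.1 + r * p.2)]
    nlinarith [sq_nonneg (|p.1| - |x * p.1 + r * p.2|), abs_nonneg p.1,
      abs_nonneg (x * p.1 + r * p.2)]
  have key := integral_abs_mul_ge hx0 hr hxr
  rw [kappa]
  simp_rw [hv]
  rw [integral_sub hqi (hai.const_mul 2), hqe, integral_const_mul]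
  linarith

/-- On the unit sphere, a positive limit forces more measurements than unknowns. -/
theorem one_lt_of_sqrt_mul_kappa_gt {α x r : ℝ} (hx0 : 0 ≤ x) (hr : 0 ≤ r)
    (hxr : x ^ 2 + r ^ 2 = 1) (h : r < √(α * kappa x r)) : 1 < α := by
  by_contra! hα
  have h1 : α * kappa x r ≤ r ^ 2 :=
    (mul_le_of_le_one_left (kappa_nonneg x r) hα).trans (kappa_le hx0 hr hxr)
  have h2 := Real.sqrt_le_sqrt h1
  rw [Real.sqrt_sq hr] at h2
  linarith

/-! ### Probabilities of the good events -/

theorem tendsto_measure_one_of_compl {Ω : ℕ → Type*} [∀ k, MeasurableSpace (Ω k)]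
    {μ : ∀ k, Measure (Ω k)} [∀ k, IsProbabilityMeasure (μ k)] {S : ∀ k, Set (Ω k)}
    (h : Tendsto (fun k => μ k (S k)ᶜ) atTop (𝓝 0)) : Tendsto (fun k => μ k (S k)) atTop (𝓝 1) := by
  have h1 : Tendsto (fun k => 1 - μ k (S k)ᶜ) atTop (𝓝 1) := by
    simpa using ENNReal.Tendsto.sub tendsto_const_nhds h (Or.inl ENNReal.one_ne_top)
  refine tendsto_of_tendsto_of_tendsto_of_le_of_le h1 tendsto_const_nhds (fun k => ?_)
    fun k => prob_le_one
  rw [tsub_le_iff_right, ← measure_univ (μ := μ k), ← Set.union_compl_self (S k)]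
  exact measure_union_le _ _

theorem gaussianReal_Iio_ne_zero : gaussianReal 0 1 (Set.Iio 0) ≠ 0 := fun h => by
  have := gaussianReal_absolutelyContinuous' 0 (one_ne_zero : (1 : NNReal) ≠ 0) h
  simp at this

theorem fpro_nonneg {M n : ℕ} (c x : ℝ) (A : Fin M → Fin n → ℝ)
    (xbar : EuclideanSpace ℝ (Fin n)) : 0 ≤ fpro c x A xbar :=
  le_iInf₂ fun _ _ => EReal.coe_nonneg.2 (Finset.sum_nonneg fun _ _ => sq_nonneg _)

/-- Gordon's comparison with the law of large numbers for `scaledGap`. The thresholds differ, as the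
comparison requires. -/
theorem tendsto_measure_mismatch_lt {α : ℝ} {m : ℕ → ℕ}
    (hm : Tendsto (fun n : ℕ => (m n : ℝ) / (n : ℝ)) atTop (𝓝 α)) {x r : ℝ} (hr : 0 ≤ r)
    {τ : ℝ} (hτ : τ < √(α * kappa x r) - r) :
    Tendsto (fun k : ℕ => gaussMatrix (m (k + 1)) (k + 1) {A | ∃ w, ∑ j, w j ^ 2 = r ^ 2 ∧
      mismatch x (fun i => A i 0) (fun i j => A i j.succ) w < τ * √((k + 1 : ℕ) : ℝ)})
      atTop (𝓝 0) := by
  obtain ⟨τ', hτ', hτ''⟩ := exists_between hτ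
  have hub := ENNReal.Tendsto.div_const (b := gaussianReal 0 1 (Set.Iio 0))
    (tendsto_measure_scaledGap_lt hm x r hτ'') (Or.inr gaussianReal_Iio_ne_zero)
  rw [ENNReal.zero_div] at hub
  refine tendsto_of_tendsto_of_tendsto_of_le_of_le tendsto_const_nhds hub (fun _ => zero_le) ?_
  intro k
  have hn : 0 < √((k + 1 : ℕ) : ℝ) := Real.sqrt_pos.2 (by positivity)
  refine (ENNReal.le_div_iff_mul_le (Or.inl gaussianReal_Iio_ne_zero)
    (Or.inl (measure_ne_top _ _))).2 ?_
  refine (gordon_mismatch (k := k) hr (mul_lt_mul_of_pos_right hτ' hn)).trans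
    (measure_mono fun G hG => ?_)
  exact (div_lt_iff₀ hn).2 hG

/-- By rotation invariance every unit vector `xbar` behaves like the first unit vector. -/
theorem tendsto_measure_fpro_lt {α : ℝ} {m : ℕ → ℕ}
    (hm : Tendsto (fun n : ℕ => (m n : ℝ) / (n : ℝ)) atTop (𝓝 α)) {c x : ℝ} (hxc : x ^ 2 ≤ c)
    {xbar : (k : ℕ) → EuclideanSpace ℝ (Fin (k + 1))} (hxbar : ∀ k, ‖xbar k‖ = 1)
    {τ : ℝ} (hτ0 : 0 ≤ τ) (hτ : τ < √(α * kappa x √(c - x ^ 2)) - √(c - x ^ 2)) :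
    Tendsto (fun k : ℕ => gaussMatrix (m (k + 1)) (k + 1)
      {A | ((τ ^ 2 : ℝ) : EReal) ≤ fpro c x A (xbar k) / (((k + 1 : ℕ) : ℝ) : EReal)}ᶜ)
      atTop (𝓝 0) := by
  refine tendsto_of_tendsto_of_tendsto_of_le_of_le tendsto_const_nhds
    (tendsto_measure_mismatch_lt hm (Real.sqrt_nonneg (c - x ^ 2)) hτ) (fun _ => zero_le) ?_
  intro k
  obtain ⟨U, hU⟩ := exists_isometry_apply_eq
    (e := (EuclideanSpace.single 0 1 : EuclideanSpace ℝ (Fin (k + 1)))) (v := xbar k)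
    (by rw [hxbar]; simp)
  have hopen : IsOpen {A : Fin (m (k + 1)) → Fin (k + 1) → ℝ |
      ∃ w, ∑ j, w j ^ 2 = √(c - x ^ 2) ^ 2 ∧
      mismatch x (fun i => A i 0) (fun i j => A i j.succ) w < τ * √((k + 1 : ℕ) : ℝ)} :=
    (isOpen_mismatch_lt x √(c - x ^ 2) (τ * √((k + 1 : ℕ) : ℝ))).preimage
      (f := fun A : Fin (m (k + 1)) → Fin (k + 1) → ℝ =>
        ((fun i => A i 0 : Fin (m (k + 1)) → ℝ), fun i j => A i (Fin.succ j))) (by fun_prop)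
  refine le_trans (measure_mono fun A hA => ?_)
    ((measurePreserving_rotate U).measure_preimage hopen.measurableSet.nullMeasurableSet).le
  by_contra hgood
  refine hA ?_
  have hge : ∀ w : Fin k → ℝ, ∑ j, w j ^ 2 = √(c - x ^ 2) ^ 2 → τ * √((k + 1 : ℕ) : ℝ) ≤
      mismatch x (fun i => rotate U A i 0) (fun i j => rotate U A i j.succ) w := fun w hw => by
    by_contra! hlt
    exact hgood ⟨w, hw, hlt⟩
  have h1 := le_fpro_single hxc (by positivity) hge
  have h2 := h1.trans (fpro_rotate_le c x U A _)
  rw [hU, mul_pow, Real.sq_sqrt (by positivity), EReal.coe_mul] at h2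
  exact (EReal.le_div_iff_mul_le (by exact_mod_cast Nat.succ_pos k) (EReal.coe_ne_top _)).2 h2

theorem exists_sq_gt_sub {ω ε : ℝ} (hω : 0 < ω) (hε : 0 < ε) :
    ∃ τ, 0 ≤ τ ∧ τ < ω ∧ ω ^ 2 - ε < τ ^ 2 := by
  have hc : ContinuousAt (fun t : ℝ => t ^ 2) ω := by fun_prop
  have h1 : ∀ᶠ t in 𝓝[<] ω, ω ^ 2 - ε < t ^ 2 :=
    (hc.eventually (lt_mem_nhds (by simpa using hε))).filter_mono nhdsWithin_le_nhds
  have h2 : ∀ᶠ t in 𝓝[<] ω, 0 ≤ t :=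
    ((lt_mem_nhds hω).mono fun _ h => le_of_lt h).filter_mono nhdsWithin_le_nhds
  obtain ⟨τ, ⟨h3, h4⟩, h5⟩ := ((h1.and h2).and self_mem_nhdsWithin).exists
  exact ⟨τ, h4, h5, h3⟩

theorem tendsto_measure_fpro_gt {α : ℝ} {m : ℕ → ℕ}
    (hm : Tendsto (fun n : ℕ => (m n : ℝ) / (n : ℝ)) atTop (𝓝 α)) {c x : ℝ} (hxc : x ^ 2 ≤ c)
    {xbar : (k : ℕ) → EuclideanSpace ℝ (Fin (k + 1))} (hxbar : ∀ k, ‖xbar k‖ = 1)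
    {ε : ℝ} (hε : 0 < ε) :
    Tendsto (fun k : ℕ => gaussMatrix (m (k + 1)) (k + 1)
      {A | ((max 0 (√(α * kappa x √(c - x ^ 2)) - √(c - x ^ 2)) ^ 2 - ε : ℝ) : EReal) <
        fpro c x A (xbar k) / (((k + 1 : ℕ) : ℝ) : EReal)}) atTop (𝓝 1) := by
  refine tendsto_measure_one_of_compl ?_
  set ω := √(α * kappa x √(c - x ^ 2)) - √(c - x ^ 2) with hω
  rcases le_or_gt ω 0 with h | h
  · have hall : ∀ k : ℕ, {A : Fin (m (k + 1)) → Fin (k + 1) → ℝ |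
        ((max 0 ω ^ 2 - ε : ℝ) : EReal) <
        fpro c x A (xbar k) / (((k + 1 : ℕ) : ℝ) : EReal)}ᶜ = ∅ := by
      intro k
      rw [Set.compl_empty_iff, Set.eq_univ_iff_forall]
      intro A
      refine lt_of_lt_of_le ?_ (EReal.div_nonneg (fpro_nonneg c x A (xbar k))
        (by exact_mod_cast Nat.zero_le _))
      rw [max_eq_left h, ← EReal.coe_zero, EReal.coe_lt_coe_iff]
      simpa using hε
    simpa only [hall, measure_empty] using tendsto_const_nhds
  · obtain ⟨τ, hτ0, hτω, hτ⟩ := exists_sq_gt_sub h hε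
    refine tendsto_of_tendsto_of_tendsto_of_le_of_le tendsto_const_nhds
      (tendsto_measure_fpro_lt hm hxc hxbar hτ0 hτω) (fun _ => zero_le) fun k => ?_
    refine measure_mono (Set.compl_subset_compl.2 fun A hA => ?_)
    have hA' : ((τ ^ 2 : ℝ) : EReal) ≤
        fpro c x A (xbar k) / (((k + 1 : ℕ) : ℝ) : EReal) := hA
    refine lt_of_lt_of_le ?_ hA'
    rw [max_eq_right h.le, EReal.coe_lt_coe_iff]
    exact hτ

/-- If `ω = √(α κ) - r` is positive, the objective is positive with probability tending to `1`,
as it even exceeds `(ω / 2)²`. -/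
theorem tendsto_measure_fpro_not_pos {α : ℝ} {m : ℕ → ℕ}
    (hm : Tendsto (fun n : ℕ => (m n : ℝ) / (n : ℝ)) atTop (𝓝 α)) {c x : ℝ} (hxc : x ^ 2 ≤ c)
    {xbar : (k : ℕ) → EuclideanSpace ℝ (Fin (k + 1))} (hxbar : ∀ k, ‖xbar k‖ = 1)
    (h : 0 < √(α * kappa x √(c - x ^ 2)) - √(c - x ^ 2)) :
    Tendsto (fun k : ℕ => gaussMatrix (m (k + 1)) (k + 1)
      {A | 0 < fpro c x A (xbar k) / (((k + 1 : ℕ) : ℝ) : EReal)}ᶜ) atTop (𝓝 0) := by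
  refine tendsto_of_tendsto_of_tendsto_of_le_of_le tendsto_const_nhds
    (tendsto_measure_fpro_lt hm hxc hxbar (half_pos h).le (half_lt_self h)) (fun _ => zero_le)
    fun k => ?_
  refine measure_mono (Set.compl_subset_compl.2 fun A hA => ?_)
  have hA' : ((((√(α * kappa x √(c - x ^ 2)) - √(c - x ^ 2)) / 2) ^ 2 : ℝ) : EReal) ≤
      fpro c x A (xbar k) / (((k + 1 : ℕ) : ℝ) : EReal) := hA
  refine lt_of_lt_of_le ?_ hA'
  rw [← EReal.coe_zero, EReal.coe_lt_coe_iff]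
  exact pow_pos (half_pos h) 2

theorem eventually_pos_of_tendsto_div {α : ℝ} (hα : 0 < α) {m : ℕ → ℕ}
    (hm : Tendsto (fun n : ℕ => (m n : ℝ) / (n : ℝ)) atTop (𝓝 α)) :
    ∀ᶠ k : ℕ in atTop, 0 < m (k + 1) ∧ 0 < k := by
  have h1 : ∀ᶠ k : ℕ in atTop, (0 : ℝ) < (m (k + 1) : ℝ) / ((k + 1 : ℕ) : ℝ) :=
    (hm.comp (tendsto_add_atTop_nat 1)).eventually (lt_mem_nhds hα)
  filter_upwards [h1, eventually_gt_atTop 0] with k hk hk0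
  refine ⟨Nat.pos_of_ne_zero fun h => ?_, hk0⟩
  rw [h] at hk
  simp at hk

theorem eventually_succ_le_of_tendsto_div {α : ℝ} (hα : 1 < α) {m : ℕ → ℕ}
    (hm : Tendsto (fun n : ℕ => (m n : ℝ) / (n : ℝ)) atTop (𝓝 α)) :
    ∀ᶠ k : ℕ in atTop, k + 1 + 1 ≤ m (k + 1) := by
  have h1 : ∀ᶠ k : ℕ in atTop, (1 : ℝ) < (m (k + 1) : ℝ) / ((k + 1 : ℕ) : ℝ) :=
    (hm.comp (tendsto_add_atTop_nat 1)).eventually (lt_mem_nhds hα)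
  filter_upwards [h1] with k hk
  rw [one_lt_div (by positivity)] at hk
  exact_mod_cast hk

theorem frd_eq_scaledGap {M k : ℕ} (hM : 0 < M) (hk : 0 < k) (c x : ℝ)
    (G : (Fin M → Fin (k + 1) → ℝ) × (Fin M → ℝ) × (Fin k → ℝ)) :
    frd c x G = ((max 0 (scaledGap x √(c - x ^ 2) G) ^ 2 : ℝ) : EReal) := by
  rw [frd_eq hM hk, scaledGap]
  congr 1
  have hn : 0 < √((k + 1 : ℕ) : ℝ) := Real.sqrt_pos.2 (by positivity)
  have hmax : max 0 (gap x √(c - x ^ 2) (fun i => G.1 i 0) G.2.1 G.2.2 / √((k + 1 : ℕ) : ℝ)) =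
      max 0 (gap x √(c - x ^ 2) (fun i => G.1 i 0) G.2.1 G.2.2) / √((k + 1 : ℕ) : ℝ) := by
    rw [← max_div_div_right hn.le, zero_div]
  rw [hmax, div_pow, Real.sq_sqrt (by positivity)]

end PhaseRetrieval

open PhaseRetrieval in
theorem theorem1 (α : ℝ) (hα : 0 < α) (m : ℕ → ℕ)
    (hm : Tendsto (fun n : ℕ => (m n : ℝ) / (n : ℝ)) atTop (𝓝 α))
    (c x : ℝ) (hc : 0 < c) (hx : 0 ≤ x) (hxc : x ^ 2 ≤ c) :
    -- the random primal is the scaled f-pro objective, with `xbar` the first unit vector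
    (∀ (M k : ℕ) (A : Fin M → Fin (k + 1) → ℝ),
      frp c x A = fpro c x A (EuclideanSpace.single 0 1) / (((k + 1 : ℕ) : ℝ) : EReal)) ∧
    -- the random dual is eventually a finite integrable random variable
    (∀ᶠ k : ℕ in atTop,
      (∀ G : (Fin (m (k + 1)) → Fin (k + 1) → ℝ) × (Fin (m (k + 1)) → ℝ) × (Fin k → ℝ),
        frd c x G ≠ ⊤ ∧ frd c x G ≠ ⊥) ∧
      Integrable (fun G => (frd c x G).toReal) (gaussTriple (m (k + 1)) k)) ∧
    ∃ φ₀ : ℝ,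
      Tendsto (fun k : ℕ => ∫ G, (frd c x G).toReal ∂(gaussTriple (m (k + 1)) k))
        atTop (𝓝 φ₀) ∧
      (∀ ε : ℝ, 0 < ε → Tendsto (fun k : ℕ => gaussMatrix (m (k + 1)) (k + 1)
        {A | ((φ₀ - ε : ℝ) : EReal) < frp c x A}) atTop (𝓝 1)) ∧
      (0 < φ₀ → Tendsto (fun k : ℕ => gaussTriple (m (k + 1)) k
        {G | 0 < frd c x G ∧ 0 < frp c x G.1}) atTop (𝓝 1)) ∧
      (0 < φ₀ → Tendsto (fun k : ℕ => gaussMatrix (m (k + 1)) (k + 1)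
        {A | 0 < frp c x A}) atTop (𝓝 1)) ∧
      -- the same for an arbitrary unit vector `xbar`, with the solvability of phase retrieval
      ∀ xbar : (k : ℕ) → EuclideanSpace ℝ (Fin (k + 1)), (∀ k, ‖xbar k‖ = 1) →
        (∀ ε : ℝ, 0 < ε → Tendsto (fun k : ℕ => gaussMatrix (m (k + 1)) (k + 1)
          {A | ((φ₀ - ε : ℝ) : EReal) < fpro c x A (xbar k) / (((k + 1 : ℕ) : ℝ) : EReal)})
          atTop (𝓝 1)) ∧
        (0 < φ₀ → Tendsto (fun k : ℕ => gaussMatrix (m (k + 1)) (k + 1)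
          {A | 0 < fpro c x A (xbar k)}) atTop (𝓝 1)) ∧
        (∀ (k : ℕ) (A : Fin (m (k + 1)) → Fin (k + 1) → ℝ),
          (∀ c' x' : ℝ, ¬(c' = 1 ∧ (x' = 1 ∨ x' = -1)) → 0 < fpro c' x' A (xbar k)) →
            UniquelySolvable A (xbar k)) ∧
        (c = 1 → 0 < φ₀ → Tendsto (fun k : ℕ => gaussMatrix (m (k + 1)) (k + 1)
          {A | UniquelySolvable A (xbar k)}) atTop (𝓝 1)) := by
  set r := √(c - x ^ 2) with hr
  set ω := √(α * kappa x r) - r with hω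
  have hfrp : ∀ (M k : ℕ) (A : Fin M → Fin (k + 1) → ℝ),
      frp c x A = fpro c x A (EuclideanSpace.single 0 1) / (((k + 1 : ℕ) : ℝ) : EReal) :=
    fun M k A => frp_eq_fpro hxc A
  have he₁ : ∀ k : ℕ, ‖(EuclideanSpace.single 0 1 : EuclideanSpace ℝ (Fin (k + 1)))‖ = 1 :=
    fun k => by simp
  have hev := eventually_pos_of_tendsto_div hα hm
  have hωpos : 0 < max 0 ω ^ 2 → 0 < ω := fun h => by
    by_contra! hle
    rw [max_eq_left hle] at h
    simp at h
  obtain ⟨hint, hlim⟩ := tendsto_integral_sq_max_scaledGap hm x r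
  refine ⟨hfrp, ?_, max 0 ω ^ 2, ?_, ?_, ?_, ?_, ?_⟩
  · filter_upwards [hev] with k hk
    refine ⟨fun G => ?_, ?_⟩
    · rw [frd_eq_scaledGap hk.1 hk.2]
      exact ⟨EReal.coe_ne_top _, EReal.coe_ne_bot _⟩
    · simp_rw [frd_eq_scaledGap hk.1 hk.2, EReal.toReal_coe]
      exact hint _ _
  · refine hlim.congr' ?_
    filter_upwards [hev] with k hk
    simp_rw [frd_eq_scaledGap hk.1 hk.2, EReal.toReal_coe]
    rfl
  · intro ε hε
    simp_rw [hfrp]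
    exact tendsto_measure_fpro_gt hm hxc he₁ hε
  · intro hφ
    refine tendsto_measure_one_of_compl ?_
    have h1 := tendsto_measure_scaledGap_lt hm x r (half_lt_self (hωpos hφ))
    have h2 := tendsto_measure_fpro_not_pos hm hxc he₁ (hωpos hφ)
    have h3 := h1.add h2
    rw [add_zero] at h3
    refine tendsto_of_tendsto_of_tendsto_of_le_of_le' tendsto_const_nhds h3
      (Eventually.of_forall fun _ => zero_le) ?_
    filter_upwards [hev] with k hk
    have hsub : {G : (Fin (m (k + 1)) → Fin (k + 1) → ℝ) × (Fin (m (k + 1)) → ℝ) × (Fin k → ℝ) |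
        0 < frd c x G ∧ 0 < frp c x G.1}ᶜ ⊆ {G | scaledGap x r G < ω / 2} ∪
        ({A | 0 < fpro c x A (EuclideanSpace.single 0 1) / (((k + 1 : ℕ) : ℝ) : EReal)}ᶜ ×ˢ
          Set.univ) := by
      intro G hG
      by_contra hnot
      rw [Set.mem_union, not_or] at hnot
      refine hG ⟨?_, ?_⟩
      · rw [frd_eq_scaledGap hk.1 hk.2, ← EReal.coe_zero, EReal.coe_lt_coe_iff]
        have h4 : ω / 2 ≤ scaledGap x r G := not_lt.1 hnot.1
        exact pow_pos (lt_max_of_lt_right ((half_pos (hωpos hφ)).trans_le h4)) 2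
      · rw [hfrp]
        by_contra hle
        exact hnot.2 ⟨hle, Set.mem_univ _⟩
    refine (measure_mono hsub).trans ((measure_union_le _ _).trans (add_le_add le_rfl ?_))
    rw [gaussTriple, Measure.prod_prod, measure_univ, mul_one]
  · intro hφ
    simp_rw [hfrp]
    exact tendsto_measure_one_of_compl (tendsto_measure_fpro_not_pos hm hxc he₁ (hωpos hφ))
  · intro xbar hxbar
    refine ⟨fun ε hε => tendsto_measure_fpro_gt hm hxc hxbar hε, fun hφ => ?_,
      fun k A => uniquelySolvable_of_fpro_pos (hxbar k), fun hc1 hφ => ?_⟩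
    · refine tendsto_measure_one_of_compl ?_
      refine tendsto_of_tendsto_of_tendsto_of_le_of_le tendsto_const_nhds
        (tendsto_measure_fpro_not_pos hm hxc hxbar (hωpos hφ)) (fun _ => zero_le) fun k => ?_
      refine measure_mono (Set.compl_subset_compl.2 fun A hA => ?_)
      refine lt_of_le_of_ne (fpro_nonneg c x A (xbar k)) fun h0 => ?_
      have hA' : 0 < fpro c x A (xbar k) / (((k + 1 : ℕ) : ℝ) : EReal) := hA
      rw [← h0, EReal.zero_div] at hA'
      exact lt_irrefl _ hA'
    · -- On the unit sphere `0 < φ₀` makes the system overdetermined, so that uniqueness holds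
      -- almost surely and not merely for one value of `x`.
      have hα1 : 1 < α := one_lt_of_sqrt_mul_kappa_gt hx (Real.sqrt_nonneg (c - x ^ 2))
        (by rw [Real.sq_sqrt (sub_nonneg.2 hxc), hc1]; ring) (sub_pos.1 (hωpos hφ))
      refine tendsto_measure_one_of_compl (tendsto_const_nhds.congr' ?_)
      filter_upwards [eventually_succ_le_of_tendsto_div hα1 hm] with k hk
      exact (ae_iff.1 (ae_uniquelySolvable hk (xbar k))).symm
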